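/- A **linear group** is an infinite set $D$ with a group structure $(D,+)$, not necessarily commutative, and a total order $\le$ that is compatible with $+$ on both sides (for example $\mathbb Z$, $\mathbb Q$, $\mathbb R$). A **streaming register transducer** (SRT) over $D$ has finite sets $\Sigma$, $\Gamma$ of input and output labels, a finite set $Q$ of states with an initial state $q_0$, a number $k\in\mathbb N$ of registers, an initial assignment $R_0\in D^k$ and a set of transitions $$\Delta\subseteq Q\times\Sigma\times\{>,=,<\}^k\times\{\mathsf{old},\mathsf{new},\mathsf{add}\}^k\times\{1,\dots,k\}\times\Gamma\times Q .$$ A configuration is a pair $(q,R)\in Q\times D^k$. A transition $(q,\sigma,l,m,u,\gamma,q')$ enables the step from $(q,R)$ to $(q',R')$ that reads $(\sigma,d)\in\Sigma\times D$ and writes $(\gamma,R'[u])$ if for every $i$ the relation $d\mathrel{l[i]}R[i]$ holds, and $R'[i]$ is $R[i]$, $d$ or $R[i]+d$ according to whether $m[i]$ is $\mathsf{old}$, $\mathsf{new}$ or $\mathsf{add}$. A run is a sequence of enabled steps starting in $(q_0,R_0)$, and $[\![\mathcal S]\!]$ is the set of the words $s\otimes t$ of input–output pairs read and written by the finite runs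 of $\mathcal S$; $[\![\mathcal S]\!]_\omega$ is the set of those of its infinite runs. $\mathcal S$ is **deterministic** (a DSRT) if distinct transitions differ in $q$, in $\sigma$ or in $l$. $\mathcal S$ is **reactive** if for every finite input data word $s$ there is an output data word $t$ of the same length with $s\otimes t\in[\![\mathcal S]\!]$. For SRTs $\mathcal S,\mathcal S'$ with the same label sets and data domain, $\mathcal S$ is **included** in $\mathcal S'$ if $[\![\mathcal S]\!]\subseteq[\![\mathcal S']\!]$. **Theorem.** Let $D$ be any linear group, and let SRTs over $D$ be given to an algorithm by listing their finite components, with initial register values given by names, the number $m\in\mathbb N$ being a name of $\nu(m)\in D$ for an arbitrary fixed map $\nu:\mathbb N\to D$ (only SRTs whose initial values have a name are inputs). Then 1. it is undecidable whether a given DSRT over $D$ is reactive; 2. it is undecidable whether a given SRT over $D$ is reactive; 3. it is undecidable, given two SRTs $\mathcal S,\mathcal S'$ over $D$ with the same label sets, whether $\mathcal S$ is included in $\mathcal S'$. All three also hold with infinite words in place of finite ones, that is, with $[\![\cdot]\!]_\omega$ in place of $[\![\cdot]\!]$, with "reactive" then meaning that for every infinite input data word $s$ there is an infinite output data word $t$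 with $s\otimes t\in[\![\mathcal S]\!]_\omega$. -/

import Mathlib

/-- The three register updates of a transition. -/
inductive RegUpdate where
  | old
  | new
  | add

/-- Value of a register after an update, where `r` is its old value and `d` the input data value. -/
def RegUpdate.apply {D : Type*} [Add D] : RegUpdate → D → D → D
  | .old, r, _ => r
  | .new, _, d => d
  | .add, r, d => r + d

/-- Transitions `(q, σ, l, m, u, γ, q')` with input labels `A`, output labels `B`,
states `Q` and `k` registers. In the guard, `.gt`, `.eq`, `.lt` stand for `>`, `=`, `<`. -/
@[ext]
structure SRTransition (A B Q : Type*) (k : ℕ) where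
  src : Q
  inLabel : A
  guard : Fin k → Ordering
  update : Fin k → RegUpdate
  outReg : Fin k
  outLabel : B
  tgt : Q

/-- Streaming register transducers with finite sets of input labels `A`, output labels `B` and
states `Q`, with data domain `D` and with `k` registers. -/
structure SRT (A B D Q : Type*) [Finite A] [Finite B] [Finite Q] (k : ℕ) where
  start : Q
  reg0 : Fin k → D
  trans : Set (SRTransition A B Q k)

namespace SRT

section Transformations

variable {A B D : Type*}

/-- A language `T` of finite transformation instances is reactive if every finite input data
word has an output data word in `T`. -/
def ReactiveLang (T : Set (List ((A × D) × (B × D)))) : Prop :=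
  ∀ s : List (A × D), ∃ t : List (B × D), t.length = s.length ∧ s.zip t ∈ T

/-- A language `T` of infinite transformation instances is reactive if every infinite input data
word has an output data word in `T`. -/
def ReactiveOmegaLang (T : Set (ℕ → (A × D) × (B × D))) : Prop :=
  ∀ s : ℕ → A × D, ∃ t : ℕ → B × D, (fun i => (s i, t i)) ∈ T

end Transformations

section Semantics

variable {A B D Q : Type*} [Finite A] [Finite B] [Finite Q] {k : ℕ}

/-- Any two transitions with the same source, input label and guard are equal. -/
def Deterministic (S : SRT A B D Q k) : Prop :=
  ∀ τ₁ ∈ S.trans, ∀ τ₂ ∈ S.trans,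
    τ₁.src = τ₂.src → τ₁.inLabel = τ₂.inLabel → τ₁.guard = τ₂.guard → τ₁ = τ₂

variable [LinearOrder D] [Add D]

/-- The transition step between the configurations `c` and `c'` that reads `x` and writes `y`. -/
def Step (S : SRT A B D Q k) (c : Q × (Fin k → D)) (x : A × D) (y : B × D)
    (c' : Q × (Fin k → D)) : Prop :=
  ∃ τ ∈ S.trans,
    τ.src = c.1 ∧ τ.inLabel = x.1 ∧
    (∀ i, (τ.guard i).Compares x.2 (c.2 i)) ∧
    (∀ i, c'.2 i = (τ.update i).apply (c.2 i) x.2) ∧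
    y = (τ.outLabel, c'.2 τ.outReg) ∧
    c'.1 = τ.tgt

/-- The transformation defined by `S`: the instances `w` of its finite runs. Only the values
`ρ 0, …, ρ w.length` matter. -/
def lang (S : SRT A B D Q k) : Set (List ((A × D) × (B × D))) :=
  {w | ∃ ρ : ℕ → Q × (Fin k → D), ρ 0 = (S.start, S.reg0) ∧
    ∀ (i : ℕ) (h : i < w.length), S.Step (ρ i) w[i].1 w[i].2 (ρ (i + 1))}

/-- The instances of the infinite runs of `S`. -/
def omegaLang (S : SRT A B D Q k) : Set (ℕ → (A × D) × (B × D)) :=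
  {w | ∃ ρ : ℕ → Q × (Fin k → D), ρ 0 = (S.start, S.reg0) ∧
    ∀ i : ℕ, S.Step (ρ i) (w i).1 (w i).2 (ρ (i + 1))}

def Reactive (S : SRT A B D Q k) : Prop := ReactiveLang S.lang

def OmegaReactive (S : SRT A B D Q k) : Prop := ReactiveOmegaLang S.omegaLang

end Semantics

section Descriptions

/-- Description of a transition by source, input label, guard, updates, output register,
output label and target. -/
abbrev TransDescr : Type := ℕ × ℕ × List ℕ × List ℕ × ℕ × ℕ × ℕ

/-- Description of a transducer: the numbers of input labels, output labels, states and
registers; the initial state; names of the initial register values; a list of the transitions. -/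
abbrev Descr : Type := (ℕ × ℕ × ℕ × ℕ) × ℕ × List ℕ × List TransDescr

def cmpCode : Ordering → ℕ
  | .lt => 0
  | .eq => 1
  | .gt => 2

def updateCode : RegUpdate → ℕ
  | .old => 0
  | .new => 1
  | .add => 2

def transCode {a b n k : ℕ} (τ : SRTransition (Fin a) (Fin b) (Fin n) k) : TransDescr :=
  (τ.src, τ.inLabel, List.ofFn fun i => cmpCode (τ.guard i),
    List.ofFn fun i => updateCode (τ.update i), τ.outReg, τ.outLabel, τ.tgt)

variable {D : Type*} (ν : ℕ → D)

/-- `c` describes `S`, where the number `m` is a name for the data value `ν m`. -/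
def Describes {a b n k : ℕ} (c : Descr) (S : SRT (Fin a) (Fin b) D (Fin n) k) : Prop :=
  c.1 = (a, b, n, k) ∧
  c.2.1 = S.start ∧
  (∃ r : Fin k → ℕ, c.2.2.1 = List.ofFn r ∧ ∀ i, S.reg0 i = ν (r i)) ∧
  {x | x ∈ c.2.2.2} = transCode '' S.trans

variable [LinearOrder D] [Add D]

/-- Some algorithm decides, for the deterministic transducers over `D`, whether they are
reactive. Its behaviour on other inputs does not matter. -/
def DSRTReactivityDecidable : Prop :=
  ∃ f : Descr → Bool, Computable f ∧
    ∀ (a b n k : ℕ) (S : SRT (Fin a) (Fin b) D (Fin n) k) (c : Descr),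
      Describes ν c S → S.Deterministic → (f c = true ↔ S.Reactive)

def SRTReactivityDecidable : Prop :=
  ∃ f : Descr → Bool, Computable f ∧
    ∀ (a b n k : ℕ) (S : SRT (Fin a) (Fin b) D (Fin n) k) (c : Descr),
      Describes ν c S → (f c = true ↔ S.Reactive)

def SRTInclusionDecidable : Prop :=
  ∃ f : Descr × Descr → Bool, Computable f ∧
    ∀ (a b n k n' k' : ℕ) (S : SRT (Fin a) (Fin b) D (Fin n) k)
      (S' : SRT (Fin a) (Fin b) D (Fin n') k') (c c' : Descr),
      Describes ν c S → Describes ν c' S' → (f (c, c') = true ↔ S.lang ⊆ S'.lang)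

def DSRTOmegaReactivityDecidable : Prop :=
  ∃ f : Descr → Bool, Computable f ∧
    ∀ (a b n k : ℕ) (S : SRT (Fin a) (Fin b) D (Fin n) k) (c : Descr),
      Describes ν c S → S.Deterministic → (f c = true ↔ S.OmegaReactive)

def SRTOmegaReactivityDecidable : Prop :=
  ∃ f : Descr → Bool, Computable f ∧
    ∀ (a b n k : ℕ) (S : SRT (Fin a) (Fin b) D (Fin n) k) (c : Descr),
      Describes ν c S → (f c = true ↔ S.OmegaReactive)

def SRTOmegaInclusionDecidable : Prop :=
  ∃ f : Descr × Descr → Bool, Computable f ∧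
    ∀ (a b n k n' k' : ℕ) (S : SRT (Fin a) (Fin b) D (Fin n) k)
      (S' : SRT (Fin a) (Fin b) D (Fin n') k') (c c' : Descr),
      Describes ν c S → Describes ν c' S' →
        (f (c, c') = true ↔ S.omegaLang ⊆ S'.omegaLang)

end Descriptions

end SRT

/-!
The halting problem is reduced to reactivity, with the input data word as a computation of a
counter machine.

A program is a regular language of actions (assignments, additions and comparisons) on finitely
many counters; it is executed by choosing one of its words and performing the actions in that word
(`Sem`). Since regular languages are closed under concatenation, union and Kleene star, the
input-output relations of programs are closed under composition, union and reflexive transitive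
closure. Choosing a word makes it possible to guess the value of a counter and to verify the guess
by tests such as `testable_pair`. With a stack coded into one counter by `Nat.pair`, this suffices
to compute all primitive recursive functions (`Realizable.of_primrec`). Guessing a bound on the
number of steps, one obtains a single program that can be executed on the input `n` if and only if
`n` belongs to some fixed undecidable set (`exists_isRegular_not_computablePred`).

For every `n` a deterministic transducer `machine` follows a finite automaton for this program.
Its input labels are the actions, and a counter with value `m` is represented by a register with
the value `m • u` for a positive element `u` of the group. The input word has to provide a zero,
the unit `u`, and then, for each action, the value of the operand that the action uses; all this is
verified by the guards. As soon as the input deviates from this format or a test fails, everything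
is accepted. A missing transition occurs only if an accepted program has been executed. Hence the
transducer has a run on every (finite or infinite) input if and only if the program cannot be
executed on the input `n` (`machine_safe_iff`).

The initial register values cannot be controlled, as the names may denote any elements. Therefore
zero is recognized as the only `d` with `r + d = r` for the initial value `r`, and `n` is brought
in by a chain of `n` states that add `u` to a register. Only this chain depends on `n`, so the
description of the transducer is primitive recursive in `n` (`exists_computable_describes`).

For inclusion, note that the transducer copies its input data to the output and has only one output
label. Hence it is reactive if and only if it includes the identity transducer
(`SRT.Copying.lang_subset_iff`).
-/

open scoped Computability

/-! ### Regular languages -/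

namespace Language

variable {α : Type*} {L M : Language α}

theorem IsRegular.mul (hL : L.IsRegular) (hM : M.IsRegular) : (L * M).IsRegular := by
  apply IsRegular.of_finite_range_leftQuotient
  have fin := hL.finite_range_leftQuotient.prod hM.finite_range_leftQuotient.powerset
  refine (fin.image fun p => p.1 * M + sSup p.2).subset ?_
  rintro _ ⟨x, rfl⟩
  refine ⟨(L.leftQuotient x, {N | ∃ a b, a ∈ L ∧ a ++ b = x ∧ M.leftQuotient b = N}),
    ⟨⟨x, rfl⟩, ?_⟩, ?_⟩
  · rintro _ ⟨a, b, -, -, rfl⟩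
    exact ⟨b, rfl⟩
  · ext y
    simp only [mem_add, mem_mul, mem_leftQuotient]
    constructor
    · rintro (⟨a, ha, b, hb, rfl⟩ | ⟨_, ⟨a, b, ha, rfl, rfl⟩, hy⟩)
      · exact ⟨x ++ a, ha, b, hb, by simp⟩
      · exact ⟨a, ha, b ++ y, hy, by simp⟩
    · rintro ⟨a, ha, b, hb, h⟩
      obtain ⟨c, rfl, rfl⟩ | ⟨c, rfl, rfl⟩ := List.append_eq_append_iff.1 h
      · exact Or.inr ⟨_, ⟨a, c, ha, rfl, rfl⟩, hb⟩
      · exact Or.inl ⟨c, ha, b, hb, rfl⟩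

/-- A factorization of `x ++ y` into words of `L` has a factor that contains the border between
`x` and `y`. -/
theorem exists_split_of_append_mem_kstar {x y : List α} (hx : x ≠ []) (h : x ++ y ∈ L∗) :
    ∃ a b c d, a ++ b = x ∧ c ++ d = y ∧ a ∈ L∗ ∧ b ++ c ∈ L ∧ d ∈ L∗ := by
  obtain ⟨ws, h, hws⟩ := mem_kstar.1 h
  induction ws generalizing x with
  | nil => simp_all
  | cons w ws ih =>
    have hw : w ∈ L := hws w (by simp)
    have hws' : ∀ u ∈ ws, u ∈ L := fun u hu => hws u (by simp [hu])
    rw [List.flatten_cons] at h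
    obtain ⟨c, rfl, rfl⟩ | ⟨c, rfl, hc⟩ := List.append_eq_append_iff.1 h
    · exact ⟨[], x, c, ws.flatten, rfl, rfl, nil_mem_kstar L, hw, mem_kstar.2 ⟨ws, rfl, hws'⟩⟩
    · by_cases hc' : c = []
      · subst hc'
        refine ⟨[], w, [], y, by simp, rfl, nil_mem_kstar L, by simpa using hw, ?_⟩
        exact mem_kstar.2 ⟨ws, by simpa using hc.symm, hws'⟩
      · obtain ⟨a, b, e, d, rfl, rfl, ha, hb, hd⟩ :=
          ih hc' (mem_kstar.2 ⟨ws, hc.symm, hws'⟩) hc.symm hws'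
        refine ⟨w ++ a, b, e, d, by simp, rfl, ?_, hb, hd⟩
        obtain ⟨vs, rfl, hvs⟩ := mem_kstar.1 ha
        refine mem_kstar.2 ⟨w :: vs, by simp, ?_⟩
        simpa [hw] using hvs

theorem IsRegular.kstar (hL : L.IsRegular) : (L∗).IsRegular := by
  apply IsRegular.of_finite_range_leftQuotient
  have fin := hL.finite_range_leftQuotient.powerset
  refine ((fin.image fun S => sSup S * L∗).insert (L∗)).subset ?_
  rintro _ ⟨x, rfl⟩
  by_cases hx : x = []
  · exact Or.inl (by simp [hx])
  refine Or.inr ⟨{N | ∃ a b, a ∈ L∗ ∧ a ++ b = x ∧ L.leftQuotient b = N}, ?_, ?_⟩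
  · rintro _ ⟨a, b, -, -, rfl⟩
    exact ⟨b, rfl⟩
  · ext y
    simp only [mem_mul, mem_leftQuotient]
    constructor
    · rintro ⟨c, ⟨_, ⟨a, b, ha, rfl, rfl⟩, hc⟩, d, hd, rfl⟩
      obtain ⟨vs, rfl, hvs⟩ := mem_kstar.1 ha
      obtain ⟨ws, rfl, hws⟩ := mem_kstar.1 hd
      refine mem_kstar.2 ⟨vs ++ (b ++ c) :: ws, by simp, fun u hu => ?_⟩
      rcases List.mem_append.1 hu with hu | hu
      · exact hvs u hu
      · rcases List.mem_cons.1 hu with rfl | hu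
        · exact hc
        · exact hws u hu
    · intro h
      obtain ⟨a, b, c, d, rfl, rfl, ha, hb, hd⟩ := exists_split_of_append_mem_kstar hx h
      exact ⟨c, ⟨_, ⟨a, b, ha, rfl, rfl⟩, hb⟩, d, hd, rfl⟩

theorem isRegular_singleton (a : α) : ({[a]} : Language α).IsRegular := by
  apply IsRegular.of_finite_range_leftQuotient
  refine (Set.toFinite {({[a]} : Language α), 1, 0}).subset ?_
  rintro _ ⟨_ | ⟨b, _ | ⟨c, x⟩⟩, rfl⟩
  · simp
  · by_cases h : b = a
    · right; left
      subst h
      ext y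
      change b :: y = [b] ↔ _
      simp [mem_one]
    · right; right
      ext y
      change b :: y = [a] ↔ _
      simp [h, notMem_zero]
  · right; right
    ext y
    change b :: c :: (x ++ y) = [a] ↔ _
    simp [notMem_zero]

end Language

/-! ### Counter programs -/

/-- The counters: fourteen named by `Sum.inl`, and two scratch counters `Sum.inr false` and
`Sum.inr true` that hold intermediate results. -/
abbrev Var : Type := Fin 14 ⊕ Bool

/-- The source operands of actions: the constants zero and one and the counters. -/
inductive Opd where
  | zero
  | one
  | var (i : Var)
  deriving DecidableEq, Fintype

/-- Actions on counters: assignment, addition, and a test on the outcome of a comparison. -/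
inductive Act where
  | copy (r : Var) (o : Opd)
  | add (r : Var) (o : Opd)
  | cmp (o₁ o₂ : Opd) (c : Ordering)
  deriving Fintype

/-- The value of an operand. -/
def Opd.val (v : Var → ℕ) : Opd → ℕ
  | .zero => 0
  | .one => 1
  | .var i => v i

/-- The effect of an action, which is undefined for a failing test. -/
def Act.exec : Act → (Var → ℕ) → Option (Var → ℕ)
  | .copy r o, v => some (Function.update v r (o.val v))
  | .add r o, v => some (Function.update v r (v r + o.val v))
  | .cmp o₁ o₂ c, v => if compare (o₁.val v) (o₂.val v) = c then some v else none

/-- The effect of a word of actions. -/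
def Act.run (w : List Act) (v : Var → ℕ) : Option (Var → ℕ) := w.foldlM (fun v a => a.exec v) v

/-- The input-output relation of a language of action words, seen as a nondeterministic program
that executes one of its words. -/
def Sem (L : Language Act) (v v' : Var → ℕ) : Prop := ∃ w ∈ L, Act.run w v = some v'

theorem sem_singleton {a : Act} {v v' : Var → ℕ} : Sem {[a]} v v' ↔ a.exec v = some v' := by
  constructor
  · rintro ⟨_, rfl, h⟩
    simpa [Act.run] using h
  · exact fun h => ⟨[a], rfl, by simpa [Act.run] using h⟩

theorem sem_copy {r : Var} {o : Opd} {v v' : Var → ℕ} :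
    Sem {[.copy r o]} v v' ↔ v' = Function.update v r (o.val v) := by
  simp [sem_singleton, Act.exec, eq_comm]

theorem sem_add {r : Var} {o : Opd} {v v' : Var → ℕ} :
    Sem {[.add r o]} v v' ↔ v' = Function.update v r (v r + o.val v) := by
  simp [sem_singleton, Act.exec, eq_comm]

theorem sem_cmp {o₁ o₂ : Opd} {c : Ordering} {v v' : Var → ℕ} :
    Sem {[.cmp o₁ o₂ c]} v v' ↔ compare (o₁.val v) (o₂.val v) = c ∧ v' = v := by
  simp [sem_singleton, Act.exec, eq_comm]

theorem sem_mul {L M : Language Act} {v v' : Var → ℕ} :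
    Sem (L * M) v v' ↔ ∃ u, Sem L v u ∧ Sem M u v' := by
  constructor
  · rintro ⟨_, ⟨a, ha, b, hb, rfl⟩, h⟩
    simp only [Act.run, List.foldlM_append, Option.bind_eq_bind, Option.bind_eq_some_iff] at h
    obtain ⟨u, h₁, h₂⟩ := h
    exact ⟨u, ⟨a, ha, h₁⟩, b, hb, h₂⟩
  · rintro ⟨u, ⟨a, ha, h₁⟩, b, hb, h₂⟩
    refine ⟨a ++ b, Language.append_mem_mul ha hb, ?_⟩
    simp only [Act.run, List.foldlM_append, Option.bind_eq_bind, Option.bind_eq_some_iff]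
    exact ⟨u, h₁, h₂⟩

theorem sem_union {L M : Language Act} {v v' : Var → ℕ} :
    Sem (L + M) v v' ↔ Sem L v v' ∨ Sem M v v' := by
  simp only [Sem, Language.mem_add, or_and_right, exists_or]

theorem sem_kstar {L : Language Act} {v v' : Var → ℕ} :
    Sem (L∗) v v' ↔ Relation.ReflTransGen (Sem L) v v' := by
  constructor
  · rintro ⟨w, hw, h⟩
    obtain ⟨ws, rfl, hws⟩ := Language.mem_kstar.1 hw
    clear hw
    induction ws generalizing v with
    | nil =>
      obtain rfl : v = v' := by simpa [Act.run] using h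
      exact .refl
    | cons w ws ih =>
      simp only [Act.run, List.flatten_cons, List.foldlM_append, Option.bind_eq_bind,
        Option.bind_eq_some_iff] at h
      obtain ⟨u, h₁, h₂⟩ := h
      exact .head ⟨w, hws w (by simp), h₁⟩ (ih (fun y hy => hws y (by simp [hy])) h₂)
  · intro h
    induction h with
    | refl => exact ⟨[], Language.nil_mem_kstar L, rfl⟩
    | tail _ h₂ ih =>
      have := sem_mul.2 ⟨_, ih, h₂⟩
      obtain ⟨w, hw, hr⟩ := this
      refine ⟨w, ?_, hr⟩
      have : L∗ * L ≤ L∗ := kstar_mul_le_kstar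
      exact this hw

/-! ### Guessing and testing -/

/-- A program that sets a counter to an arbitrary value. -/
def guess (r : Var) : Language Act := {[.copy r .zero]} * {[.add r .one]}∗

theorem isRegular_guess (r : Var) : (guess r).IsRegular :=
  (Language.isRegular_singleton _).mul (Language.isRegular_singleton _).kstar

theorem sem_guess {r : Var} {v v' : Var → ℕ} :
    Sem (guess r) v v' ↔ ∃ n, v' = Function.update v r n := by
  simp only [guess, sem_mul, sem_copy, exists_eq_left, sem_kstar]
  constructor
  · intro h
    induction h with
    | refl => exact ⟨_, rfl⟩
    | tail _ h ih =>
      obtain ⟨n, rfl⟩ := ih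
      exact ⟨n + 1, by simpa [Opd.val] using sem_add.1 h⟩
  · rintro ⟨n, rfl⟩
    induction n with
    | zero => exact .refl
    | succ n ih => exact ih.tail (sem_add.2 (by simp [Opd.val]))

/-- Every finite set of counters can be guessed. -/
theorem exists_guess_finset (s : Finset Var) :
    ∃ L : Language Act, L.IsRegular ∧ ∀ v v', Sem L v v' ↔ ∀ r ∉ s, v' r = v r := by
  induction s using Finset.induction_on with
  | empty =>
    -- The empty program is the test that zero equals zero.
    refine ⟨_, Language.isRegular_singleton (.cmp .zero .zero .eq), fun v v' => ?_⟩
    simp [sem_cmp, funext_iff]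
  | insert r s hr ih =>
    obtain ⟨L, hL, h⟩ := ih
    refine ⟨guess r * L, (isRegular_guess r).mul hL, fun v v' => ?_⟩
    simp only [sem_mul, sem_guess, h]
    constructor
    · rintro ⟨_, ⟨n, rfl⟩, h⟩ x hx
      simp only [Finset.mem_insert, not_or] at hx
      rw [h x hx.2, Function.update_of_ne hx.1]
    · intro h
      refine ⟨_, ⟨v' r, rfl⟩, fun x hx => ?_⟩
      by_cases hxr : x = r
      · subst hxr; simp
      · rw [Function.update_of_ne hxr]
        exact h x (by simp [hxr, hx])

/-- `L` tests the predicate `φ` of the named counters without changing them. It may change the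
scratch counters. -/
def TestsFor (L : Language Act) (φ : (Fin 14 → ℕ) → Prop) : Prop :=
  (∀ v v', Sem L v v' → v' ∘ Sum.inl = v ∘ Sum.inl ∧ φ (v ∘ Sum.inl)) ∧
    ∀ v, φ (v ∘ Sum.inl) → ∃ v', Sem L v v'

/-- A predicate of the named counters that some regular program tests. -/
def Testable (φ : (Fin 14 → ℕ) → Prop) : Prop :=
  ∃ L : Language Act, L.IsRegular ∧ TestsFor L φ

theorem Testable.and {φ ψ : (Fin 14 → ℕ) → Prop} (hφ : Testable φ) (hψ : Testable ψ) :
    Testable fun u => φ u ∧ ψ u := by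
  obtain ⟨L, hL, h₁, h₂⟩ := hφ
  obtain ⟨M, hM, h₃, h₄⟩ := hψ
  refine ⟨L * M, hL.mul hM, fun v v' h => ?_, fun v h => ?_⟩
  · obtain ⟨u, hu, hu'⟩ := sem_mul.1 h
    have hu := h₁ _ _ hu
    have hu' := h₃ _ _ hu'
    rw [hu.1] at hu'
    exact ⟨hu'.1, hu.2, hu'.2⟩
  · obtain ⟨u, hu⟩ := h₂ v h.1
    obtain ⟨v', hv'⟩ := h₄ u (by rw [(h₁ _ _ hu).1]; exact h.2)
    exact ⟨v', sem_mul.2 ⟨u, hu, hv'⟩⟩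

theorem Testable.or {φ ψ : (Fin 14 → ℕ) → Prop} (hφ : Testable φ) (hψ : Testable ψ) :
    Testable fun u => φ u ∨ ψ u := by
  obtain ⟨L, hL, h₁, h₂⟩ := hφ
  obtain ⟨M, hM, h₃, h₄⟩ := hψ
  refine ⟨L + M, hL.add hM, fun v v' h => ?_, fun v h => ?_⟩
  · rcases sem_union.1 h with h | h
    · exact ⟨(h₁ _ _ h).1, Or.inl (h₁ _ _ h).2⟩
    · exact ⟨(h₃ _ _ h).1, Or.inr (h₃ _ _ h).2⟩
  · rcases h with h | h
    · exact (h₂ v h).imp fun _ h => sem_union.2 (Or.inl h)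
    · exact (h₄ v h).imp fun _ h => sem_union.2 (Or.inr h)

/-- A program whose effect is a function `f` that leaves the named counters alone makes predicates
testable that compare the values it computes. -/
theorem testable_of_cmp {L : Language Act} (hL : L.IsRegular) (f : (Var → ℕ) → Var → ℕ)
    (hsem : ∀ v v', Sem L v v' ↔ v' = f v) (hf : ∀ v, f v ∘ Sum.inl = v ∘ Sum.inl)
    (o₁ o₂ : Opd) (c : Ordering) {φ : (Fin 14 → ℕ) → Prop}
    (h : ∀ v, compare (o₁.val (f v)) (o₂.val (f v)) = c ↔ φ (v ∘ Sum.inl)) : Testable φ := by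
  refine ⟨L * {[.cmp o₁ o₂ c]}, hL.mul (Language.isRegular_singleton _), fun v v' h' => ?_,
    fun v h' => ⟨f v, ?_⟩⟩
  · simp only [sem_mul, hsem, exists_eq_left, sem_cmp] at h'
    exact ⟨h'.2 ▸ hf v, (h v).1 h'.1⟩
  · simp only [sem_mul, hsem, exists_eq_left, sem_cmp]
    exact ⟨(h v).2 h', trivial⟩

theorem testable_cmp (o₁ o₂ : Opd) (c : Ordering) {φ : (Fin 14 → ℕ) → Prop}
    (h : ∀ v, compare (o₁.val v) (o₂.val v) = c ↔ φ (v ∘ Sum.inl)) : Testable φ := by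
  refine ⟨_, Language.isRegular_singleton (.cmp o₁ o₂ c), fun v v' h' => ?_, fun v h' => ⟨v, ?_⟩⟩
  · rw [sem_cmp] at h'
    exact ⟨by rw [h'.2], (h v).1 h'.1⟩
  · exact sem_cmp.2 ⟨(h v).2 h', rfl⟩

theorem testable_zero (i : Fin 14) : Testable fun u => u i = 0 :=
  testable_cmp (.var (.inl i)) .zero .eq fun v => by simp [Opd.val]

theorem testable_eq (i j : Fin 14) : Testable fun u => u i = u j :=
  testable_cmp (.var (.inl i)) (.var (.inl j)) .eq fun v => by simp [Opd.val]

theorem testable_lt (i j : Fin 14) : Testable fun u => u i < u j :=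
  testable_cmp (.var (.inl i)) (.var (.inl j)) .lt fun v => by
    simp [Opd.val, compare_lt_iff_lt]

theorem testable_succ (i j : Fin 14) : Testable fun u => u i = u j + 1 := by
  refine testable_of_cmp (L := {[.copy (.inr true) (.var (.inl j))]} * {[.add (.inr true) .one]})
    ((Language.isRegular_singleton _).mul (Language.isRegular_singleton _))
    (fun v => Function.update v (.inr true) (v (.inl j) + 1)) (fun v v' => ?_)
    ?_ (.var (.inl i)) (.var (.inr true)) .eq fun v => ?_
  · simp only [sem_mul, sem_copy, sem_add, exists_eq_left]
    simp [Opd.val]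
  · intro v; ext; simp
  · simp [Opd.val]

/-- A program that puts the square of the named counter `i` into the scratch counter
`Sum.inr true`. -/
def square (i : Fin 14) : Language Act :=
  {[.copy (.inr true) .zero]} * ({[.copy (.inr false) .zero]} *
    (({[.add (.inr true) (.var (.inl i))]} * {[.add (.inr false) .one]})∗ *
      {[.cmp (.var (.inr false)) (.var (.inl i)) .eq]}))

theorem isRegular_square (i : Fin 14) : (square i).IsRegular := by
  have h := @Language.isRegular_singleton Act
  exact (h _).mul ((h _).mul (((h _).mul (h _)).kstar.mul (h _)))

theorem sem_square {i : Fin 14} {v v' : Var → ℕ} : Sem (square i) v v' ↔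
    v' = Sum.elim (v ∘ Sum.inl) fun b => if b then v (.inl i) * v (.inl i) else v (.inl i) := by
  have key : ∀ v', Relation.ReflTransGen
      (Sem ({[.add (.inr true) (.var (.inl i))]} * {[.add (.inr false) .one]}))
      (Sum.elim (v ∘ Sum.inl) fun _ => 0) v' ↔
      ∃ n, v' = Sum.elim (v ∘ Sum.inl) fun b => if b then n * v (.inl i) else n := by
    intro v'
    constructor
    · intro h
      induction h with
      | refl => exact ⟨0, by simp⟩
      | tail _ h ih =>
        obtain ⟨n, rfl⟩ := ih
        simp only [sem_mul, sem_add, exists_eq_left] at h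
        refine ⟨n + 1, ?_⟩
        subst h
        ext (j | _ | _) <;> simp only [Opd.val, Function.update_apply] <;> simp [add_mul]
    · rintro ⟨n, rfl⟩
      induction n with
      | zero => simpa using .refl
      | succ n ih =>
        refine ih.tail ?_
        simp only [sem_mul, sem_add, exists_eq_left]
        ext (j | _ | _) <;> simp only [Opd.val, Function.update_apply] <;> simp [add_mul]
  have init : Function.update (Function.update v (Sum.inr true) (Opd.zero.val v)) (Sum.inr false)
      (Opd.zero.val (Function.update v (Sum.inr true) (Opd.zero.val v))) =
        Sum.elim (v ∘ Sum.inl) fun _ => 0 := by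
    ext (j | _ | _) <;> simp [Opd.val]
  simp only [square, sem_mul, sem_copy, exists_eq_left, init, sem_kstar, key, sem_cmp]
  constructor
  · rintro ⟨_, ⟨n, rfl⟩, h, rfl⟩
    obtain rfl : n = v (.inl i) := by simpa [Opd.val] using h
    rfl
  · rintro rfl
    exact ⟨_, ⟨v (.inl i), rfl⟩, by simp [Opd.val], rfl⟩

theorem testable_pair (k i j : Fin 14) : Testable fun u => u k = Nat.pair (u i) (u j) := by
  have h₁ : Testable fun u => u k = u j * u j + u i := by
    refine testable_of_cmp (L := square j * {[.add (.inr true) (.var (.inl i))]})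
      ((isRegular_square j).mul (Language.isRegular_singleton _))
      (fun v => Sum.elim (v ∘ Sum.inl) fun b =>
        if b then v (.inl j) * v (.inl j) + v (.inl i) else v (.inl j)) (fun v v' => ?_)
      ?_ (.var (.inl k)) (.var (.inr true)) .eq fun v => ?_
    · simp only [sem_mul, sem_square, sem_add, exists_eq_left]
      refine Eq.congr_right ?_
      ext (j | _ | _) <;> simp only [Opd.val, Function.update_apply] <;> simp
    · intro v; ext; simp
    · simp [Opd.val]
  have h₂ : Testable fun u => u k = u i * u i + u i + u j := by
    refine testable_of_cmp (L := square i * ({[.add (.inr true) (.var (.inl i))]} *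
      {[.add (.inr true) (.var (.inl j))]})) ((isRegular_square i).mul
      ((Language.isRegular_singleton _).mul (Language.isRegular_singleton _)))
      (fun v => Sum.elim (v ∘ Sum.inl) fun b =>
        if b then v (.inl i) * v (.inl i) + v (.inl i) + v (.inl j) else v (.inl i))
      (fun v v' => ?_)
      ?_ (.var (.inl k)) (.var (.inr true)) .eq fun v => ?_
    · simp only [sem_mul, sem_square, sem_add, exists_eq_left]
      refine Eq.congr_right ?_
      ext (j | _ | _) <;> simp only [Opd.val, Function.update_apply] <;> simp
    · intro v; ext; simp
    · simp [Opd.val]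
  have h := ((testable_lt i j).and h₁).or
    (((testable_lt j i).or (testable_eq i j)).and h₂)
  convert h using 2 with u
  rw [Nat.pair]
  have : (u j < u i ∨ u i = u j) ↔ ¬ u i < u j := by omega
  rw [this]
  split_ifs with h <;> simp [h]

/-! ### Stack programs and primitive recursion -/

/-- `L` realizes the relation `r` between pairs of numbers if executing `L` changes the values of
the first two counters according to `r`, whatever the values of the other counters are. The first
counter holds the current value, the second one a stack that is coded by `Nat.pair`. -/
def Realizes (L : Language Act) (r : ℕ × ℕ → ℕ × ℕ → Prop) : Prop :=
  ∀ v q, (∃ v', Sem L v v' ∧ (v' (.inl 0), v' (.inl 1)) = q) ↔ r (v (.inl 0), v (.inl 1)) q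

/-- A relation between pairs of numbers that is realized by a regular program. -/
def Realizable (r : ℕ × ℕ → ℕ × ℕ → Prop) : Prop :=
  ∃ L : Language Act, L.IsRegular ∧ Realizes L r

namespace Realizable

theorem comp {r r' : ℕ × ℕ → ℕ × ℕ → Prop} (h : Realizable r) (h' : Realizable r') :
    Realizable fun p q => ∃ o, r p o ∧ r' o q := by
  obtain ⟨L, hL, h⟩ := h
  obtain ⟨M, hM, h'⟩ := h'
  refine ⟨L * M, hL.mul hM, fun v q => ?_⟩
  simp only [sem_mul]
  constructor
  · rintro ⟨v', ⟨u, hu, hu'⟩, hq⟩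
    exact ⟨_, (h v _).1 ⟨u, hu, rfl⟩, (h' u q).1 ⟨v', hu', hq⟩⟩
  · rintro ⟨o, ho, ho'⟩
    obtain ⟨u, hu, rfl⟩ := (h v o).2 ho
    obtain ⟨v', hv', hq⟩ := (h' u q).2 ho'
    exact ⟨v', ⟨u, hu, hv'⟩, hq⟩

theorem star {r : ℕ × ℕ → ℕ × ℕ → Prop} (h : Realizable r) :
    Realizable (Relation.ReflTransGen r) := by
  obtain ⟨L, hL, h⟩ := h
  refine ⟨L∗, hL.kstar, fun v q => ?_⟩
  simp only [sem_kstar]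
  constructor
  · rintro ⟨v', hv', rfl⟩
    exact hv'.lift (fun v => (v (.inl 0), v (.inl 1))) fun a b hab => (h a _).1 ⟨b, hab, rfl⟩
  · intro hq
    induction hq with
    | refl => exact ⟨v, .refl, rfl⟩
    | tail _ hr ih =>
      obtain ⟨u, hu, rfl⟩ := ih
      obtain ⟨v', hv', hq⟩ := (h u _).2 hr
      exact ⟨v', hu.tail hv', hq⟩

/-- A relation is realizable if it is the projection of a testable relation: guess the values of
all other counters, test them, and copy the third and fourth counters to the first two. -/
theorem of_testable {φ : (Fin 14 → ℕ) → Prop} (hφ : Testable φ) {r : ℕ × ℕ → ℕ × ℕ → Prop}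
    (h : ∀ p q, r p q ↔ ∃ u, φ u ∧ (u 0, u 1) = p ∧ (u 2, u 3) = q) : Realizable r := by
  obtain ⟨M, hM, h₁, h₂⟩ := hφ
  obtain ⟨G, hG, hsem⟩ := exists_guess_finset (Finset.univ \ {.inl 0, .inl 1})
  refine ⟨G * (M * ({[.copy (.inl 0) (.var (.inl 2))]} * {[.copy (.inl 1) (.var (.inl 3))]})),
    hG.mul (hM.mul ((Language.isRegular_singleton _).mul (Language.isRegular_singleton _))),
    fun v q => ?_⟩
  simp only [sem_mul, hsem, h, sem_copy, exists_eq_left]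
  constructor
  · rintro ⟨_, ⟨u, hu, u', hu', rfl⟩, rfl⟩
    have huu := h₁ _ _ hu'
    have h2 : u' (.inl 2) = u (.inl 2) := congrFun huu.1 2
    have h3 : u' (.inl 3) = u (.inl 3) := congrFun huu.1 3
    refine ⟨_, huu.2, ?_, ?_⟩
    · simp [hu (.inl 0), hu (.inl 1)]
    · simp [Opd.val, h2, h3]
  · rintro ⟨u, hu, hp, rfl⟩
    rw [Prod.mk.injEq] at hp
    obtain ⟨u', hu'⟩ := h₂ (Sum.elim u fun _ => 0) (by simpa using hu)
    have huu := (h₁ _ _ hu').1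
    have h2 : u' (.inl 2) = u 2 := congrFun huu 2
    have h3 : u' (.inl 3) = u 3 := congrFun huu 3
    refine ⟨_, ⟨Sum.elim u fun _ => 0, ?_, u', hu', rfl⟩, ?_⟩
    · intro x hx
      obtain rfl | rfl : x = .inl 0 ∨ x = .inl 1 := by
        simpa [or_iff_not_imp_left] using hx
      · exact hp.1
      · exact hp.2
    · simp [Opd.val, h2, h3]

/-- The relation of a total function on the value that keeps the stack. -/
abbrev Computes (f : ℕ → ℕ) : Prop := Realizable fun p q => q = (f p.1, p.2)

theorem zero : Computes fun _ => 0 := by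
  refine of_testable ((testable_zero 2).and (testable_eq 3 1)) fun ⟨x, s⟩ ⟨y, t⟩ => ?_
  constructor
  · rintro ⟨⟩
    exact ⟨![x, s, 0, s, 0, 0, 0, 0, 0, 0, 0, 0, 0, 0], by simp⟩
  · rintro ⟨u, ⟨h₁, h₂⟩, ⟨⟩, ⟨⟩⟩
    simp [h₁, h₂]

theorem succ : Computes Nat.succ := by
  refine of_testable ((testable_succ 2 0).and (testable_eq 3 1)) fun ⟨x, s⟩ ⟨y, t⟩ => ?_
  constructor
  · rintro ⟨⟩
    exact ⟨![x, s, x + 1, s, 0, 0, 0, 0, 0, 0, 0, 0, 0, 0], by simp⟩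
  · rintro ⟨u, ⟨h₁, h₂⟩, ⟨⟩, ⟨⟩⟩
    simp [h₁, h₂]

theorem left : Computes fun n => n.unpair.1 := by
  refine of_testable ((testable_pair 0 2 4).and (testable_eq 3 1)) fun ⟨x, s⟩ ⟨y, t⟩ => ?_
  constructor
  · rintro ⟨⟩
    exact ⟨![x, s, x.unpair.1, s, x.unpair.2, 0, 0, 0, 0, 0, 0, 0, 0, 0], by simp⟩
  · rintro ⟨u, ⟨h₁, h₂⟩, ⟨⟩, ⟨⟩⟩
    simp [h₁, h₂]

theorem right : Computes fun n => n.unpair.2 := by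
  refine of_testable ((testable_pair 0 4 2).and (testable_eq 3 1)) fun ⟨x, s⟩ ⟨y, t⟩ => ?_
  constructor
  · rintro ⟨⟩
    exact ⟨![x, s, x.unpair.2, s, x.unpair.1, 0, 0, 0, 0, 0, 0, 0, 0, 0], by simp⟩
  · rintro ⟨u, ⟨h₁, h₂⟩, ⟨⟩, ⟨⟩⟩
    simp [h₁, h₂]

/-- Push a copy of the current value. -/
theorem dup : Realizable fun p q => q = (p.1, Nat.pair p.1 p.2) := by
  refine of_testable ((testable_eq 2 0).and (testable_pair 3 0 1)) fun ⟨x, s⟩ ⟨y, t⟩ => ?_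
  constructor
  · rintro ⟨⟩
    exact ⟨![x, s, x, Nat.pair x s, 0, 0, 0, 0, 0, 0, 0, 0, 0, 0], by simp⟩
  · rintro ⟨u, ⟨h₁, h₂⟩, ⟨⟩, ⟨⟩⟩
    simp [h₁, h₂]

/-- Exchange the current value and the top of the stack. -/
theorem swap : Realizable fun p q => ∃ b, p.2 = Nat.pair q.1 b ∧ q.2 = Nat.pair p.1 b := by
  refine of_testable ((testable_pair 1 2 4).and (testable_pair 3 0 4)) fun ⟨x, s⟩ ⟨y, t⟩ => ?_
  constructor
  · rintro ⟨b, h₁, h₂⟩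
    exact ⟨![x, s, y, t, b, 0, 0, 0, 0, 0, 0, 0, 0, 0], by simpa using ⟨h₁, h₂⟩⟩
  · rintro ⟨u, ⟨h₁, h₂⟩, ⟨⟩, ⟨⟩⟩
    exact ⟨_, h₁, h₂⟩

/-- Pair the top of the stack with the current value. -/
theorem join : Realizable fun p q => ∃ a, p.2 = Nat.pair a q.2 ∧ q.1 = Nat.pair a p.1 := by
  refine of_testable ((testable_pair 1 4 3).and (testable_pair 2 4 0)) fun ⟨x, s⟩ ⟨y, t⟩ => ?_
  constructor
  · rintro ⟨b, h₁, h₂⟩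
    exact ⟨![x, s, y, t, b, 0, 0, 0, 0, 0, 0, 0, 0, 0], by simpa using ⟨h₁, h₂⟩⟩
  · rintro ⟨u, ⟨h₁, h₂⟩, ⟨⟩, ⟨⟩⟩
    exact ⟨_, h₁, h₂⟩

theorem congr {r r' : ℕ × ℕ → ℕ × ℕ → Prop} (h : Realizable r) (H : ∀ p q, r p q ↔ r' p q) :
    Realizable r' := by
  have : r = r' := by ext p q; exact H p q
  exact this ▸ h

theorem pair {f g : ℕ → ℕ} (hf : Computes f) (hg : Computes g) :
    Computes fun n => Nat.pair (f n) (g n) := by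
  refine (dup.comp (hf.comp (swap.comp (hg.comp join)))).congr fun p q => ?_
  simp only [exists_eq_left]
  constructor
  · rintro ⟨⟨o₁, o₂⟩, ⟨b, h₁, h₂⟩, a, h₃, h₄⟩
    simp only [Nat.pair_eq_pair] at h₁ h₂ h₃ h₄
    subst h₂
    rw [Nat.pair_eq_pair] at h₃
    obtain ⟨rfl, rfl⟩ := h₁
    obtain ⟨rfl, h₃⟩ := h₃
    exact Prod.ext h₄ h₃.symm
  · rintro rfl
    exact ⟨(p.1, Nat.pair (f p.1) p.2), ⟨p.2, rfl, rfl⟩, f p.1, rfl, rfl⟩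

/-- Start of a primitive recursion: the current value `Nat.pair a n` becomes `a`, and a record
with the parameter `a`, the loop counter zero and the bound `n` is pushed. -/
theorem prec_start : Realizable fun p q =>
    q = (p.1.unpair.1, Nat.pair (Nat.pair p.1.unpair.1 (Nat.pair 0 p.1.unpair.2)) p.2) := by
  -- The guessed counters are `n`, `0`, `Nat.pair 0 n` and the record.
  refine of_testable ((((testable_pair 0 2 4).and (testable_zero 5)).and
    ((testable_pair 6 5 4).and (testable_pair 7 2 6))).and (testable_pair 3 7 1))
    fun ⟨x, s⟩ ⟨y, t⟩ => ?_
  constructor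
  · rintro ⟨⟩
    exact ⟨![x, s, x.unpair.1, Nat.pair (Nat.pair x.unpair.1 (Nat.pair 0 x.unpair.2)) s,
      x.unpair.2, 0, Nat.pair 0 x.unpair.2, Nat.pair x.unpair.1 (Nat.pair 0 x.unpair.2),
      0, 0, 0, 0, 0, 0], by simp⟩
  · rintro ⟨u, ⟨⟨⟨h₁, h₂⟩, h₃, h₄⟩, h₅⟩, ⟨⟩, ⟨⟩⟩
    simp [h₁, h₂, h₃, h₄, h₅]

/-- A round of a primitive recursion: the arguments of the step function are assembled from the
current value and the record, and the loop counter is increased. -/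
theorem prec_round : Realizable fun p q => ∃ a y n s,
    p.2 = Nat.pair (Nat.pair a (Nat.pair y n)) s ∧
      q = (Nat.pair a (Nat.pair y p.1), Nat.pair (Nat.pair a (Nat.pair (y + 1) n)) s) := by
  -- Counters 4 to 7 hold `a`, `y`, `n` and `s`, the others are intermediate results.
  refine of_testable (((((testable_pair 8 5 6).and (testable_pair 9 4 8)).and
    ((testable_pair 1 9 7).and (testable_pair 10 5 0))).and
    (((testable_pair 2 4 10).and (testable_succ 11 5)).and
    ((testable_pair 12 11 6).and (testable_pair 13 4 12)))).and (testable_pair 3 13 7))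
    fun ⟨x, s⟩ ⟨y, t⟩ => ?_
  constructor
  · rintro ⟨a, y, n, s, h, h'⟩
    obtain rfl : _ = Nat.pair _ _ := h
    cases h'
    exact ⟨![x, Nat.pair (Nat.pair a (Nat.pair y n)) s, Nat.pair a (Nat.pair y x),
      Nat.pair (Nat.pair a (Nat.pair (y + 1) n)) s, a, y, n, s, Nat.pair y n,
      Nat.pair a (Nat.pair y n), Nat.pair y x, y + 1, Nat.pair (y + 1) n,
      Nat.pair a (Nat.pair (y + 1) n)], by simp⟩
  · rintro ⟨u, ⟨⟨⟨⟨h₁, h₂⟩, h₃, h₄⟩, ⟨h₅, h₆⟩, h₇, h₈⟩, h₉⟩, ⟨⟩, ⟨⟩⟩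
    exact ⟨u 4, u 5, u 6, u 7, by simp [h₁, h₂, h₃], by simp [h₄, h₅, h₆, h₇, h₈, h₉]⟩

/-- End of a primitive recursion: if the loop counter has reached the bound, the record is
popped. -/
theorem prec_end : Realizable fun p q => ∃ a n s,
    p.2 = Nat.pair (Nat.pair a (Nat.pair n n)) s ∧ q = (p.1, s) := by
  refine of_testable (((testable_pair 6 5 5).and (testable_pair 7 4 6)).and
    ((testable_pair 1 7 3).and (testable_eq 2 0))) fun ⟨x, s⟩ ⟨y, t⟩ => ?_
  constructor
  · rintro ⟨a, n, r, h, h'⟩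
    obtain rfl : _ = Nat.pair _ _ := h
    cases h'
    exact ⟨![x, Nat.pair (Nat.pair a (Nat.pair n n)) t, x, t, a, n, Nat.pair n n,
      Nat.pair a (Nat.pair n n), 0, 0, 0, 0, 0, 0], by simp⟩
  · rintro ⟨u, ⟨⟨h₁, h₂⟩, h₃, h₄⟩, ⟨⟩, ⟨⟩⟩
    exact ⟨u 4, u 5, u 3, by simp [h₁, h₂, h₃], by simp [h₄]⟩

theorem prec {f g : ℕ → ℕ} (hf : Computes f) (hg : Computes g) :
    Computes (Nat.unpaired fun a n =>
      n.rec (f a) fun y ih => g (Nat.pair a (Nat.pair y ih))) := by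
  refine (prec_start.comp (hf.comp ((prec_round.comp hg).star.comp prec_end))).congr
    fun ⟨x, s⟩ q => ?_
  simp only [exists_eq_left, Nat.unpaired]
  generalize x.unpair.1 = a
  generalize x.unpair.2 = n
  -- The values after `m` rounds of the loop; nothing stops it from going beyond `n` rounds.
  let F : ℕ → ℕ := fun m => m.rec (f a) fun y ih => g (Nat.pair a (Nat.pair y ih))
  have key : ∀ o, Relation.ReflTransGen (fun p q => ∃ o : ℕ × ℕ, (∃ a y n s,
      p.2 = Nat.pair (Nat.pair a (Nat.pair y n)) s ∧
        o = (Nat.pair a (Nat.pair y p.1), Nat.pair (Nat.pair a (Nat.pair (y + 1) n)) s)) ∧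
      q = (g o.1, o.2)) (f a, Nat.pair (Nat.pair a (Nat.pair 0 n)) s) o ↔
      ∃ m, o = (F m, Nat.pair (Nat.pair a (Nat.pair m n)) s) := by
    intro o
    constructor
    · intro h
      induction h with
      | refl => exact ⟨0, rfl⟩
      | tail _ h ih =>
        obtain ⟨m, rfl⟩ := ih
        obtain ⟨_, ⟨a', y, n', s', h, rfl⟩, rfl⟩ := h
        simp only [Nat.pair_eq_pair] at h
        obtain ⟨⟨rfl, rfl, rfl⟩, rfl⟩ := h
        exact ⟨m + 1, rfl⟩
    · rintro ⟨m, rfl⟩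
      induction m with
      | zero => exact .refl
      | succ m ih => exact ih.tail ⟨_, ⟨a, m, n, s, rfl, rfl⟩, rfl⟩
  simp only [key]
  constructor
  · rintro ⟨_, ⟨m, rfl⟩, a', n', s', h, rfl⟩
    simp only [Nat.pair_eq_pair] at h
    obtain ⟨⟨rfl, rfl, rfl⟩, rfl⟩ := h
    rfl
  · rintro rfl
    exact ⟨_, ⟨n, rfl⟩, a, n, s, rfl, rfl⟩

/-- Every primitive recursive function is computed by a regular program. -/
theorem of_primrec {f : ℕ → ℕ} (hf : Nat.Primrec f) : Computes f := by
  induction hf with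
  | zero => exact zero
  | succ => exact succ
  | left => exact left
  | right => exact right
  | pair _ _ hf hg => exact hf.pair hg
  | comp _ _ hf hg => exact (hg.comp hf).congr fun p q => by simp
  | prec _ _ hf hg => exact hf.prec hg

/-- Replace the current value `n` by a pair `Nat.pair n m` with a guessed `m`. -/
theorem guess_pair : Realizable fun p q => ∃ m, q = (Nat.pair p.1 m, p.2) := by
  refine of_testable ((testable_pair 2 0 4).and (testable_eq 3 1)) fun ⟨x, s⟩ ⟨y, t⟩ => ?_
  constructor
  · rintro ⟨m, h⟩
    cases h
    exact ⟨![x, s, Nat.pair x m, s, m, 0, 0, 0, 0, 0, 0, 0, 0, 0], by simp⟩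
  · rintro ⟨u, ⟨h₁, h₂⟩, ⟨⟩, ⟨⟩⟩
    exact ⟨u 4, by simp [h₁, h₂]⟩

/-- Test that the current value is zero. -/
theorem test_zero : Realizable fun p q => p.1 = 0 ∧ q = p := by
  refine of_testable ((testable_zero 0).and ((testable_eq 2 0).and (testable_eq 3 1)))
    fun ⟨x, s⟩ ⟨y, t⟩ => ?_
  constructor
  · rintro ⟨h, h'⟩
    cases h'
    exact ⟨![x, s, x, s, 0, 0, 0, 0, 0, 0, 0, 0, 0, 0], by simpa using h⟩
  · rintro ⟨u, ⟨h₁, h₂, h₃⟩, ⟨⟩, ⟨⟩⟩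
    exact ⟨h₁, by simp [h₂, h₃]⟩

end Realizable

/-- The initial values of the counters: `n` in the first one and zero in the others. -/
def initVal (n : ℕ) : Var → ℕ := Function.update 0 (.inl 0) n

/-- Some undecidable predicate is recognized by a regular program. -/
theorem exists_isRegular_not_computablePred : ∃ L : Language Act, L.IsRegular ∧
    ¬ ComputablePred fun n : ℕ => ∃ w ∈ L, (Act.run w (initVal n)).isSome := by
  -- A code is decoded from its number and halts on zero if some step bound suffices.
  let h : ℕ × ℕ → ℕ := fun x =>
    if (Nat.Partrec.Code.evaln x.2 (Denumerable.ofNat Nat.Partrec.Code x.1) 0).isSome then 0 else 1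
  have hh : Primrec h := by
    refine Primrec.ite (PrimrecPred.comp (p := fun b : Bool => b = true) ?_ ?_) (Primrec.const 0)
      (Primrec.const 1)
    · exact Primrec.eq.comp Primrec.id (Primrec.const true)
    · refine Primrec.option_isSome.comp ?_
      exact Nat.Partrec.Code.primrec_evaln.comp
        ((Primrec.snd.pair ((Primrec.ofNat _).comp Primrec.fst)).pair (Primrec.const 0))
  have hp : Nat.Primrec fun n => h n.unpair := Primrec.nat_iff.1 (hh.comp Primrec.unpair)
  obtain ⟨L, hL, hr⟩ :=
    Realizable.guess_pair.comp ((Realizable.of_primrec hp).comp Realizable.test_zero)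
  refine ⟨L, hL, fun hK => ?_⟩
  refine ComputablePred.halting_problem 0 ?_
  refine ComputablePred.computable_of_manyOneReducible
    ⟨Encodable.encode (α := Nat.Partrec.Code), Computable.encode, fun c => ?_⟩ hK
  have hr : ∀ n, (∃ w ∈ L, (Act.run w (initVal n)).isSome) ↔ ∃ m, h (n, m) = 0 := by
    intro n
    have hn := hr (initVal n)
    simp only [exists_eq_left, initVal, Function.update_self] at hn
    constructor
    · rintro ⟨w, hw, hs⟩
      obtain ⟨v', hv'⟩ := Option.isSome_iff_exists.1 hs
      obtain ⟨_, ⟨m, rfl⟩, h, -⟩ := (hn _).1 ⟨v', ⟨w, hw, hv'⟩, rfl⟩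
      exact ⟨m, by simpa using h⟩
    · rintro ⟨m, hm⟩
      obtain ⟨v', ⟨w, hw, h⟩, -⟩ := (hn _).2 ⟨_, ⟨m, rfl⟩, by simpa using hm, rfl⟩
      exact ⟨w, hw, by rw [initVal, h]; rfl⟩
  refine Iff.symm ((hr _).trans ?_)
  beta_reduce
  rw [Part.dom_iff_mem]
  simp only [h, Nat.Partrec.Code.evaln_complete, Denumerable.ofNat_encode]
  simp only [Option.isSome_iff_exists, Option.mem_def, ite_eq_left_iff, one_ne_zero, imp_false,
    not_not]
  exact exists_comm

/-! ### Transducers that copy their input data -/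

namespace SRT

/-- Every transition writes the input data value that it reads. -/
def Copying {A B D Q : Type*} [Finite A] [Finite B] [Finite Q] {k : ℕ} (S : SRT A B D Q k) :
    Prop :=
  ∀ τ ∈ S.trans, τ.update τ.outReg = .new

/-- The identity transducer, with one state and one register. -/
def identity (A : Type*) {D : Type*} [Finite A] (d : D) : SRT A (Fin 1) D (Fin 1) 1 where
  start := 0
  reg0 := fun _ => d
  trans := {τ | τ.update = fun _ => .new}

theorem identity_copying {A D : Type*} [Finite A] (d : D) : (identity A d).Copying := by
  intro τ (hτ : τ.update = _)
  rw [hτ]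

theorem identity_deterministic {A D : Type*} [Finite A] (d : D) : (identity A d).Deterministic := by
  intro τ (hτ : τ.update = _) τ' (hτ' : τ'.update = _) h₁ h₂ h₃
  ext1
  · exact h₁
  · exact h₂
  · exact h₃
  · rw [hτ, hτ']
  all_goals exact Subsingleton.elim _ _

variable {A B D Q : Type*} [Finite A] [Finite B] [Finite Q] {k : ℕ} [LinearOrder D] [Add D]

/-- The configurations that occur in runs. -/
inductive Reach (S : SRT A B D Q k) : Q × (Fin k → D) → Prop
  | start : S.Reach (S.start, S.reg0)
  | step {c x y c'} : S.Reach c → S.Step c x y c' → S.Reach c'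

/-- Every configuration that occurs in a run enables a step for every input. -/
def Safe (S : SRT A B D Q k) : Prop := ∀ c, S.Reach c → ∀ x, ∃ y c', S.Step c x y c'

variable {S : SRT A B D Q k}

theorem Copying.output_eq (hS : S.Copying) {c c' : Q × (Fin k → D)} {x : A × D} {y : B × D}
    (h : S.Step c x y c') : y.2 = x.2 := by
  obtain ⟨τ, hτ, -, -, -, hu, rfl, -⟩ := h
  simp [hu, hS τ hτ, RegUpdate.apply]

theorem Deterministic.step_unique (hS : S.Deterministic) {c c₁ c₂ : Q × (Fin k → D)} {x : A × D}
    {y₁ y₂ : B × D} (h₁ : S.Step c x y₁ c₁) (h₂ : S.Step c x y₂ c₂) : c₁ = c₂ := by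
  obtain ⟨τ, hτ, hq, hl, hg, hu, -, ht⟩ := h₁
  obtain ⟨τ', hτ', hq', hl', hg', hu', -, ht'⟩ := h₂
  obtain rfl : τ = τ' := hS τ hτ τ' hτ' (hq.trans hq'.symm) (hl.trans hl'.symm)
    (funext fun i => (hg i).cmp_eq.symm.trans (hg' i).cmp_eq)
  exact Prod.ext (ht.trans ht'.symm) (funext fun i => (hu i).trans (hu' i).symm)

/-- In a deterministic transducer, the configurations of a run are determined by the input. -/
theorem Deterministic.run_unique (hS : S.Deterministic) {s : ℕ → A × D}
    {ρ₁ ρ₂ : ℕ → Q × (Fin k → D)} (h0 : ρ₁ 0 = ρ₂ 0) {m : ℕ}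
    (h₁ : ∀ i < m, ∃ y, S.Step (ρ₁ i) (s i) y (ρ₁ (i + 1)))
    (h₂ : ∀ i < m, ∃ y, S.Step (ρ₂ i) (s i) y (ρ₂ (i + 1))) : ρ₁ m = ρ₂ m := by
  induction m with
  | zero => exact h0
  | succ m ih =>
    have := ih (fun i hi => h₁ i (by omega)) fun i hi => h₂ i (by omega)
    obtain ⟨_, h⟩ := h₁ m (by omega)
    obtain ⟨_, h'⟩ := h₂ m (by omega)
    exact hS.step_unique h (this ▸ h')

theorem Reach.exists_run {c : Q × (Fin k → D)} (h : S.Reach c) (x₀ : A × D) :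
    ∃ (m : ℕ) (s : ℕ → A × D) (ρ : ℕ → Q × (Fin k → D)),
      ρ 0 = (S.start, S.reg0) ∧ ρ m = c ∧ ∀ i < m, ∃ y, S.Step (ρ i) (s i) y (ρ (i + 1)) := by
  induction h with
  | start => exact ⟨0, fun _ => x₀, fun _ => _, rfl, rfl, by simp⟩
  | @step c x y c' _ hs ih =>
    obtain ⟨m, s, ρ, h0, hm, hρ⟩ := ih
    refine ⟨m + 1, Function.update s m x, Function.update ρ (m + 1) c',
      ?_, by simp, fun i hi => ?_⟩
    · rw [Function.update_of_ne (by omega), h0]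
    · rcases Nat.lt_succ_iff_lt_or_eq.1 hi with hi | rfl
      · rw [Function.update_of_ne (by omega), Function.update_of_ne (by omega),
          Function.update_of_ne (by omega)]
        exact hρ i hi
      · rw [Function.update_of_ne (by omega)]
        exact ⟨y, by simpa [hm] using hs⟩

/-- Safe transducers have an infinite run on every infinite input. -/
theorem Safe.exists_run (hS : S.Safe) (s : ℕ → A × D) :
    ∃ (y : ℕ → B × D) (ρ : ℕ → Q × (Fin k → D)), ρ 0 = (S.start, S.reg0) ∧
      ∀ i, S.Step (ρ i) (s i) (y i) (ρ (i + 1)) := by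
  choose y c hc using hS
  let ρ : ℕ → {c // S.Reach c} := fun i =>
    i.rec ⟨_, .start⟩ fun i p => ⟨c p.1 p.2 (s i), p.2.step (hc p.1 p.2 (s i))⟩
  exact ⟨fun i => y (ρ i).1 (ρ i).2 (s i), fun i => (ρ i).1, rfl,
    fun i => hc (ρ i).1 (ρ i).2 (s i)⟩

theorem Deterministic.reactive_iff_safe (hS : S.Deterministic) : S.Reactive ↔ S.Safe := by
  constructor
  · intro h c hc x
    obtain ⟨m, s, ρ, h0, rfl, hρ⟩ := hc.exists_run x
    obtain ⟨t, ht, ρ', h0', hρ'⟩ := h (List.ofFn fun i : Fin (m + 1) => if i < m then s i else x)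
    simp only [List.length_ofFn] at ht
    have step : ∀ i (hi : i < m + 1),
        S.Step (ρ' i) (if i < m then s i else x) t[i] (ρ' (i + 1)) := by
      intro i hi
      have := hρ' i (by simp only [List.length_zip, List.length_ofFn, ht, min_self, hi])
      rwa [List.getElem_zip, List.getElem_ofFn] at this
    have := hS.run_unique (m := m) (s := s) (h0.trans h0'.symm) hρ fun i hi =>
      ⟨_, by simpa only [if_pos hi] using step i (by omega)⟩
    exact ⟨_, _, by simpa [this] using step m (by omega)⟩
  · intro h s
    by_cases hs : s = []
    · exact ⟨[], by simp [hs], fun _ => (S.start, S.reg0), rfl, by simp⟩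
    obtain ⟨y, ρ, h0, hρ⟩ := h.exists_run fun i => s.getD i (s.head hs)
    refine ⟨List.ofFn fun i : Fin s.length => y i, by simp, ρ, h0, fun i hi => ?_⟩
    have hi' : i < s.length := by simpa using hi
    simpa [hi'] using hρ i

theorem Deterministic.omegaReactive_iff_safe (hS : S.Deterministic) :
    S.OmegaReactive ↔ S.Safe := by
  constructor
  · intro h c hc x
    obtain ⟨m, s, ρ, h0, rfl, hρ⟩ := hc.exists_run x
    obtain ⟨t, ρ', h0', hρ'⟩ := h fun i => if i < m then s i else x
    have := hS.run_unique (m := m) (s := s)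
      (h0.trans h0'.symm) hρ fun i hi => ⟨_, by simpa [hi] using hρ' i⟩
    exact ⟨_, _, by simpa [this] using hρ' m⟩
  · intro h s
    obtain ⟨y, ρ, h0, hρ⟩ := h.exists_run s
    exact ⟨y, ρ, h0, hρ⟩

theorem Copying.eq_of_mem_lang [Subsingleton B] (hS : S.Copying)
    {w : List ((A × D) × (B × D))} (hw : w ∈ S.lang) (i : ℕ) (hi : i < w.length) :
    w[i].2.2 = w[i].1.2 := by
  obtain ⟨ρ, -, hρ⟩ := hw
  exact hS.output_eq (hρ i hi)

/-- For copying transducers with one output label, a reactive transducer is included in another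
transducer if and only if the latter is reactive. -/
theorem Copying.lang_subset_iff [Subsingleton B] {Q' : Type*} [Finite Q'] {k' : ℕ}
    {T : SRT A B D Q' k'} (hT : T.Copying) (hT' : T.Reactive) (hS : S.Copying) :
    T.lang ⊆ S.lang ↔ S.Reactive := by
  constructor
  · intro h s
    exact (hT' s).imp fun t ht => ⟨ht.1, h ht.2⟩
  · intro h w hw
    obtain ⟨t, ht, htS⟩ := h (w.map Prod.fst)
    have hlen : ((w.map Prod.fst).zip t).length = w.length := by simp_all
    convert htS
    refine List.ext_getElem hlen.symm fun i h₁ h₂ => ?_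
    have e₁ := hT.eq_of_mem_lang hw i h₁
    have e₂ := hS.eq_of_mem_lang htS i h₂
    ext1
    · simp
    · refine Prod.ext (Subsingleton.elim _ _) ?_
      rw [e₁, e₂]
      simp

theorem Copying.omegaLang_subset_iff [Subsingleton B] {Q' : Type*} [Finite Q'] {k' : ℕ}
    {T : SRT A B D Q' k'} (hT : T.Copying) (hT' : T.OmegaReactive) (hS : S.Copying) :
    T.omegaLang ⊆ S.omegaLang ↔ S.OmegaReactive := by
  constructor
  · intro h s
    exact (hT' s).imp fun t ht => h ht
  · intro h w hw
    obtain ⟨t, htS⟩ := h fun i => (w i).1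
    obtain ⟨ρ, -, hρ⟩ := hw
    have : w = fun i => ((w i).1, t i) := by
      obtain ⟨ρ', -, hρ'⟩ := htS
      refine funext fun i => Prod.ext rfl (Prod.ext (Subsingleton.elim _ _) ?_)
      rw [hT.output_eq (hρ i), ← hS.output_eq (hρ' i)]
    rwa [this]

theorem identity_safe (d : D) : (identity A d).Safe := by
  intro c _ x
  exact ⟨(0, x.2), (0, fun _ => x.2),
    ⟨c.1, x.1, fun i => cmp x.2 (c.2 i), fun _ => .new, 0, 0, 0⟩, rfl, rfl, rfl,
    fun i => cmp_compares _ _, fun _ => rfl, rfl, rfl⟩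

end SRT

/-! ### The transducer of a counter program -/

/-- The registers: one for the output, two to check that the first data value is zero, and one for
each operand of the counter actions. -/
inductive Reg where
  | out
  | base
  | shifted
  | opd (o : Opd)
  deriving DecidableEq, Fintype

/-- The control states apart from those that load the initial value of the first counter: three
states of an initialization phase, the states of an automaton that reads a program, and a state in
which all further input is accepted.

In `init₀`, a value `d` is stored in all operand registers and added to the initial value `r₀` in
`Reg.shifted`. In `init₁`, the next value has to equal both `r₀` and `r₀ + d`, so that `d = 0`.
In `init₂`, a positive value is stored as the unit. -/
inductive Ctl (σ : Type) where
  | init₀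
  | init₁
  | init₂
  | run (q : σ)
  | sink
  deriving Fintype

/-- The register updates that only write the input data value. -/
def idle : Reg → RegUpdate
  | .out => .new
  | _ => .old

/-- The operand whose value is to be read in order to perform an action. -/
def Act.src : Act → Opd
  | .copy _ o => o
  | .add _ o => o
  | .cmp o _ _ => o

/-- The guard tells that the value of the source operand is read, and that the test of the action,
if there is one, succeeds. -/
def Act.Enabled (a : Act) (g : Reg → Ordering) : Prop :=
  g (.opd a.src) = .eq ∧
    match a with
    | .cmp _ o c => g (.opd o) = c
    | _ => True

/-- The register updates that perform an action. -/
def Act.upd : Act → Reg → RegUpdate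
  | .copy r _ => Function.update idle (.opd (.var r)) .new
  | .add r _ => Function.update idle (.opd (.var r)) .add
  | .cmp _ _ _ => idle

/-- The action that adds one to the first counter. -/
abbrev Act.load : Act := .add (.inl 0) .one

section Transitions

variable {σ : Type} (M : DFA Act σ)

open Classical in
/-- The updates and the target of the transitions from the states in `Ctl`, where `none` stands for
the first loading state as the target. The input labels are the actions and a label `none` for the
end of a program. The only missing transitions are those that end an accepted program. -/
noncomputable def ctlStep : Ctl σ → Option Act → (Reg → Ordering) →
    Option ((Reg → RegUpdate) × Option (Ctl σ))
  | .init₀, _, _ => some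
      (fun | .out => .new | .base => .old | .shifted => .add | .opd _ => .new, some .init₁)
  | .init₁, _, g =>
      some (idle, some (if g .base = .eq ∧ g .shifted = .eq then .init₂ else .sink))
  | .init₂, _, g =>
      if g (.opd .zero) = .gt then some (Function.update idle (.opd .one) .new, none)
      else some (idle, some .sink)
  | .run q, none, _ => if q ∈ M.accept then none else some (idle, some .sink)
  | .run q, some a, g =>
      if a.Enabled g then some (a.upd, some (.run (M.step q a))) else some (idle, some .sink)
  | .sink, _, _ => some (idle, some .sink)

open Classical in
/-- The updates of a transition from a loading state, and the number of loading steps that it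
performs. -/
noncomputable def loadStep (g : Reg → Ordering) : (Reg → RegUpdate) × ℕ :=
  if Act.load.Enabled g then (Act.load.upd, 1) else (idle, 0)

/-- The transitions of the transducer that simulates the program `M` on the input `n`. The state
`Sum.inr j` is reached when the first counter has the value `j`. -/
inductive SimTrans (n : ℕ) : Ctl σ ⊕ ℕ → Option Act → (Reg → Ordering) → (Reg → RegUpdate) →
    Ctl σ ⊕ ℕ → Prop
  | ctl {c a g u c'} : ctlStep M c a g = some (u, c') →
      SimTrans n (.inl c) a g u (c'.elim (.inr 0) .inl)
  | load {j a g} : j < n → SimTrans n (.inr j) a g (loadStep g).1 (.inr (j + (loadStep g).2))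
  | finish {a g} : SimTrans n (.inr n) a g idle (.inl (.run M.start))

variable {M}

theorem SimTrans.unique {n : ℕ} {s : Ctl σ ⊕ ℕ} {a : Option Act} {g : Reg → Ordering}
    {u u' : Reg → RegUpdate} {s₁ s₂ : Ctl σ ⊕ ℕ} (h : SimTrans M n s a g u s₁)
    (h' : SimTrans M n s a g u' s₂) : u = u' ∧ s₁ = s₂ := by
  cases h with
  | ctl h =>
    cases h' with
    | ctl h' => simp_all
  | load h =>
    cases h' with
    | load h' => simp
    | finish => omega
  | finish =>
    cases h' with
    | load h' => omega
    | finish => simp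

theorem loadStep_le (g : Reg → Ordering) : (loadStep g).2 ≤ 1 := by
  unfold loadStep
  split_ifs <;> simp

/-- All transitions write the register `Reg.out`. -/
theorem SimTrans.update_out {n : ℕ} {s s' : Ctl σ ⊕ ℕ} {a : Option Act} {g : Reg → Ordering}
    {u : Reg → RegUpdate} (h : SimTrans M n s a g u s') : u .out = .new := by
  have hupd : ∀ a : Act, a.upd .out = .new := by
    rintro (_ | _ | _) <;> simp [Act.upd, idle]
  cases h with
  | @ctl c _ _ _ c' h =>
    cases c with
    | init₀ =>
      obtain ⟨rfl, -⟩ := by simpa [ctlStep] using h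
      rfl
    | init₁ =>
      obtain ⟨rfl, -⟩ := by simpa [ctlStep] using h
      rfl
    | init₂ =>
      simp only [ctlStep] at h
      split_ifs at h <;> obtain ⟨rfl, -⟩ := by simpa using h
      · simp [idle]
      · rfl
    | run q =>
      cases a with
      | none =>
        simp only [ctlStep] at h
        split_ifs at h
        obtain ⟨rfl, -⟩ := by simpa using h
        rfl
      | some a =>
        simp only [ctlStep] at h
        split_ifs at h <;> obtain ⟨rfl, -⟩ := by simpa using h
        · exact hupd a
        · rfl
    | sink =>
      obtain ⟨rfl, -⟩ := by simpa [ctlStep] using h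
      rfl
  | load h =>
    unfold loadStep
    split_ifs
    · exact hupd Act.load
    · rfl
  | finish => rfl

end Transitions

/-! ### Multiples of a positive element as counter values -/

section Simulation

variable {D : Type*} [AddGroup D]

/-- The operand registers hold the values of the operands as multiples of `u`. -/
def Holds (v : Var → ℕ) (u : D) (R : Reg → D) : Prop := ∀ o, R (.opd o) = o.val v • u

variable {v v' : Var → ℕ} {u d : D} {R R' : Reg → D} {a : Act}

theorem Holds.idle (h : Holds v u R) (hR : ∀ r, R' r = (idle r).apply (R r) d) : Holds v u R' :=
  fun o => (hR _).trans (h o)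

variable [LinearOrder D]

theorem cmp_nsmul [AddLeftMono D] {u : D} (hu : 0 < u) (a b : ℕ) :
    cmp (a • u) (b • u) = compare a b := by
  have h : StrictMono fun n : ℕ => n • u := fun a b h => nsmul_lt_nsmul_left hu h
  rw [← cmp_eq_compare]
  exact h.cmp_map_eq a b

/-- An enabled action has the intended effect. -/
theorem Holds.exec [AddLeftMono D] (h : Holds v u R) (hu : 0 < u)
    (ha : a.Enabled fun r => cmp d (R r))
    (hR : ∀ r, R' r = (a.upd r).apply (R r) d) : ∃ v', a.exec v = some v' ∧ Holds v' u R' := by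
  obtain ⟨h₁, h₂⟩ := ha
  obtain rfl : d = a.src.val v • u := by rw [cmp_eq_eq_iff] at h₁; rw [h₁, h]
  cases a with
  | copy r o =>
    refine ⟨_, rfl, fun o' => (hR _).trans ?_⟩
    rcases o' with _ | _ | i
    · simpa [Act.upd, _root_.idle, RegUpdate.apply, Opd.val] using h .zero
    · simpa [Act.upd, _root_.idle, RegUpdate.apply, Opd.val] using h .one
    · by_cases hi : i = r
      · subst hi
        simp [Act.upd, RegUpdate.apply, Opd.val, Act.src]
      · simpa [Act.upd, hi, _root_.idle, RegUpdate.apply, Opd.val] using h (.var i)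
  | add r o =>
    refine ⟨_, rfl, fun o' => (hR _).trans ?_⟩
    rcases o' with _ | _ | i
    · simpa [Act.upd, _root_.idle, RegUpdate.apply, Opd.val] using h .zero
    · simpa [Act.upd, _root_.idle, RegUpdate.apply, Opd.val] using h .one
    · by_cases hi : i = r
      · subst hi
        simp [Act.upd, RegUpdate.apply, Opd.val, Act.src, h (.var i), add_nsmul]
      · simpa [Act.upd, hi, _root_.idle, RegUpdate.apply, Opd.val] using h (.var i)
  | cmp o₁ o₂ c =>
    refine ⟨v, ?_, h.idle hR⟩
    simp only [h o₂, Act.src, cmp_nsmul hu] at h₂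
    simp [Act.exec, h₂]

/-- An action is enabled if the value of its source operand is read and its test succeeds. -/
theorem Holds.enabled [AddLeftMono D] (h : Holds v u R) (hu : 0 < u) (ha : a.exec v = some v') :
    a.Enabled fun r => cmp (a.src.val v • u) (R r) := by
  refine ⟨by simp [h a.src], ?_⟩
  cases a with
  | copy r o => trivial
  | add r o => trivial
  | cmp o₁ o₂ c =>
    have : compare (o₁.val v) (o₂.val v) = c := by
      by_contra hc
      simp [Act.exec, hc] at ha
    simp [h o₂, Act.src, cmp_nsmul hu, this]

theorem Act.run_concat (w : List Act) (a : Act) (v : Var → ℕ) :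
    Act.run (w ++ [a]) v = (Act.run w v).bind a.exec := by
  simp [Act.run]

theorem exec_load (j : ℕ) : Act.load.exec (initVal j) = some (initVal (j + 1)) := by
  simp [Act.exec, initVal, Opd.val]

variable {σ : Type} (M : DFA Act σ) (r₀ : D) (n : ℕ)

/-- The registers that are possible in each state. -/
def SimInv : Ctl σ ⊕ ℕ → (Reg → D) → Prop
  | .inl .init₀, R => ∀ r, R r = r₀
  | .inl .init₁, R => R .base = r₀ ∧ ∃ d, R .shifted = r₀ + d ∧ ∀ o, R (.opd o) = d
  | .inl .init₂, R => ∀ o, R (.opd o) = 0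
  | .inr j, R => j ≤ n ∧ ∃ u, 0 < u ∧ Holds (initVal j) u R
  | .inl (.run q), R => ∃ u, 0 < u ∧ ∃ w v, M.eval w = q ∧ Act.run w (initVal n) = some v ∧
      Holds v u R
  | .inl .sink, _ => True

variable {M r₀ n}

theorem SimInv.trans [AddLeftMono D] {s s' : Ctl σ ⊕ ℕ} {a : Option Act}
    {U : Reg → RegUpdate} (h : SimInv M r₀ n s R)
    (ht : SimTrans M n s a (fun r => cmp d (R r)) U s') (hR : ∀ r, R' r = (U r).apply (R r) d) :
    SimInv M r₀ n s' R' := by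
  cases ht with
  | @ctl c _ _ _ c' hc =>
    cases c with
    | init₀ =>
      obtain ⟨rfl, rfl⟩ := by simpa [ctlStep] using hc
      exact ⟨(hR _).trans (h _), d, (hR _).trans (congrArg (· + d) (h _)), fun o => hR _⟩
    | init₁ =>
      obtain ⟨rfl, rfl⟩ := by simpa [ctlStep] using hc
      obtain ⟨hb, e, hs, ho⟩ := h
      split_ifs with hg
      · have h₁ : d = R .base := hg.1
        have h₂ : d = R .shifted := hg.2
        obtain rfl : e = 0 := by
          rw [h₁, hb, hs] at h₂
          simpa using h₂
        exact fun o => (hR _).trans (ho o)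
      · trivial
    | init₂ =>
      simp only [ctlStep] at hc
      split_ifs at hc with hg
      · obtain ⟨rfl, rfl⟩ := by simpa using hc
        have hd : 0 < d := by
          rw [cmp_eq_gt_iff, h .zero] at hg
          exact hg
        refine ⟨Nat.zero_le n, d, hd, fun o => (hR _).trans ?_⟩
        rcases o with _ | _ | i
        · simpa [idle, RegUpdate.apply, Opd.val] using h .zero
        · simp [RegUpdate.apply, Opd.val]
        · simpa [idle, RegUpdate.apply, Opd.val, initVal] using h (.var i)
      · obtain ⟨rfl, rfl⟩ := by simpa using hc
        trivial
    | run q =>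
      cases a with
      | none =>
        simp only [ctlStep] at hc
        split_ifs at hc with hg
        obtain ⟨rfl, rfl⟩ := by simpa using hc
        trivial
      | some a =>
        simp only [ctlStep] at hc
        split_ifs at hc with hg
        · obtain ⟨rfl, rfl⟩ := by simpa using hc
          obtain ⟨u, hu, w, v, rfl, hv, hh⟩ := h
          obtain ⟨v', hv', hh'⟩ := hh.exec hu hg hR
          exact ⟨u, hu, w ++ [a], v', by simp, by simpa [Act.run_concat, hv] using hv', hh'⟩
        · obtain ⟨rfl, rfl⟩ := by simpa using hc
          trivial
    | sink =>
      obtain ⟨rfl, rfl⟩ := by simpa [ctlStep] using hc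
      trivial
  | @load j _ _ hj =>
    obtain ⟨-, u, hu, hh⟩ := h
    unfold loadStep at hR ⊢
    split_ifs at hR ⊢ with hg
    · obtain ⟨v', hv', hh'⟩ := hh.exec hu hg hR
      rw [exec_load, Option.some_inj] at hv'
      exact ⟨hj, u, hu, hv' ▸ hh'⟩
    · exact ⟨hj.le, u, hu, hh.idle hR⟩
  | finish =>
    obtain ⟨-, u, hu, hh⟩ := h
    exact ⟨u, hu, [], _, rfl, rfl, hh.idle hR⟩

/-- If no accepted program can be executed, then all transitions exist that are needed. -/
theorem SimInv.exists_trans (hM : ∀ w ∈ M.accepts, ¬ (Act.run w (initVal n)).isSome)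
    {s : Ctl σ ⊕ ℕ} (h : SimInv M r₀ n s R) (a : Option Act) (g : Reg → Ordering) :
    ∃ U s', SimTrans M n s a g U s' := by
  rcases s with c | j
  · suffices ∃ p, ctlStep M c a g = some p from ⟨_, _, .ctl this.choose_spec⟩
    cases c with
    | init₀ => exact ⟨_, rfl⟩
    | init₁ => exact ⟨_, rfl⟩
    | init₂ => simp only [ctlStep]; split_ifs <;> exact ⟨_, rfl⟩
    | run q =>
      cases a with
      | some a => simp only [ctlStep]; split_ifs <;> exact ⟨_, rfl⟩
      | none =>
        obtain ⟨u, hu, w, v, rfl, hv, hh⟩ := h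
        simp only [ctlStep]
        rw [if_neg fun hw : M.eval w ∈ M.accept => hM w hw (by simp [hv])]
        exact ⟨_, rfl⟩
    | sink => exact ⟨_, rfl⟩
  · rcases h.1.lt_or_eq with hj | rfl
    · exact ⟨_, _, .load hj⟩
    · exact ⟨_, _, .finish⟩

/-- Configurations that can be reached by a sequence of steps. -/
inductive SimReach (M : DFA Act σ) (r₀ : D) (n : ℕ) : Ctl σ ⊕ ℕ → (Reg → D) → Prop
  | start : SimReach M r₀ n (.inl .init₀) fun _ => r₀
  | step {s R a d U s'} : SimReach M r₀ n s R → SimTrans M n s a (fun r => cmp d (R r)) U s' →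
      SimReach M r₀ n s' fun r => (U r).apply (R r) d

/-- The state in which the program starts can be reached with the first counter equal to `n`. -/
theorem SimReach.loaded [AddLeftMono D] [Nontrivial D] (M : DFA Act σ) (r₀ : D) (n : ℕ) :
    ∃ u : D, 0 < u ∧ ∃ R, Holds (initVal n) u R ∧ SimReach M r₀ n (.inl (.run M.start)) R := by
  obtain ⟨u, hu⟩ : ∃ u : D, 0 < u := by
    obtain ⟨e, he⟩ := exists_ne (0 : D)
    rcases he.lt_or_gt with h | h
    · exact ⟨-e, neg_pos.2 h⟩
    · exact ⟨e, h⟩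
  have h₁ := (start (M := M) (r₀ := r₀) (n := n)).step (a := none) (d := 0) (.ctl rfl)
  have h₂ := h₁.step (a := none) (d := r₀) (.ctl rfl)
  simp only [RegUpdate.apply, add_zero, cmp_self_eq_eq, and_self, if_true] at h₂
  have h₃ := h₂.step (a := none) (d := u) (s' := .inr 0) (.ctl (c' := none)
    (by simp only [ctlStep]; rw [if_pos]; simpa [RegUpdate.apply, idle] using hu))
  have h₄ : ∀ j ≤ n, ∃ R, Holds (initVal j) u R ∧ SimReach M r₀ n (.inr j) R := by
    intro j hj
    induction j with
    | zero =>
      refine ⟨_, fun o => ?_, h₃⟩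
      rcases o with _ | _ | i <;> simp [idle, RegUpdate.apply, Opd.val, initVal]
    | succ j ih =>
      obtain ⟨R, hR, hr⟩ := ih (by omega)
      have en := hR.enabled hu (exec_load j)
      have h := hr.step (a := none) (.load (g := fun r => cmp (Act.load.src.val (initVal j) • u)
        (R r)) (by omega))
      rw [loadStep, if_pos en] at h
      obtain ⟨v', hv', hh⟩ := hR.exec hu en fun _ => rfl
      rw [exec_load, Option.some_inj] at hv'
      exact ⟨_, hv' ▸ hh, h⟩
  obtain ⟨R, hR, hr⟩ := h₄ n le_rfl
  exact ⟨u, hu, _, hR.idle (d := 0) fun _ => rfl, hr.step (a := none) .finish⟩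

/-- Every word of actions that can be executed can be read. -/
theorem SimReach.run [AddLeftMono D] [Nontrivial D] (M : DFA Act σ) (r₀ : D) (n : ℕ) {w : List Act}
    (hw : Act.run w (initVal n) = some v) :
    ∃ u : D, 0 < u ∧ ∃ R, Holds v u R ∧ SimReach M r₀ n (.inl (.run (M.eval w))) R := by
  induction w using List.reverseRecOn generalizing v with
  | nil =>
    cases hw
    exact SimReach.loaded M r₀ n
  | append_singleton w a ih =>
    rw [Act.run_concat, Option.bind_eq_some_iff] at hw
    obtain ⟨v₁, hv₁, hv⟩ := hw
    obtain ⟨u, hu, R, hR, hr⟩ := ih hv₁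
    have en := hR.enabled hu hv
    obtain ⟨v', hv', hh⟩ := hR.exec hu en fun _ => rfl
    obtain rfl : v = v' := by simpa [hv] using hv'
    refine ⟨u, hu, _, hh, ?_⟩
    rw [DFA.eval_append_singleton]
    exact hr.step (a := some a) (.ctl (c' := some _) (by rw [ctlStep, if_pos en]))

end Simulation

/-! ### Descriptions of the transducers -/

/-- A numbering of the registers. -/
noncomputable def regEquiv : Reg ≃ Fin (Fintype.card Reg) := Fintype.equivFin Reg

/-- A numbering of the input labels. -/
noncomputable def labelEquiv : Option Act ≃ Fin (Fintype.card (Option Act)) :=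
  Fintype.equivFin (Option Act)

section Machine

variable {σ : Type} [Fintype σ] (M : DFA Act σ)

/-- The number of a state. The control states come first, so that their numbers and those of the
transitions between them do not depend on the number of loading states. -/
noncomputable def stateCode : Ctl σ ⊕ ℕ → ℕ
  | .inl c => Fintype.equivFin (Ctl σ) c
  | .inr j => Fintype.card (Ctl σ) + j

theorem stateCode_injective : Function.Injective (stateCode (σ := σ)) := by
  have h (c : Ctl σ) := (Fintype.equivFin (Ctl σ) c).isLt
  rintro (c | i) (c' | j) hc <;> simp only [stateCode] at hc
  · rw [Fin.val_inj, (Fintype.equivFin (Ctl σ)).apply_eq_iff_eq] at hc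
    rw [hc]
  · have := h c
    omega
  · have := h c'
    omega
  · rw [Nat.add_left_cancel hc]

theorem stateCode_inl_lt (c : Ctl σ) (n : ℕ) :
    stateCode (.inl c) < Fintype.card (Ctl σ) + (n + 1) := by
  have := (Fintype.equivFin (Ctl σ) c).isLt
  simp only [stateCode]
  omega

variable {M} in
theorem SimTrans.stateCode_lt {n : ℕ} {s s' : Ctl σ ⊕ ℕ} {a : Option Act} {g : Reg → Ordering}
    {u : Reg → RegUpdate} (h : SimTrans M n s a g u s') :
    stateCode s < Fintype.card (Ctl σ) + (n + 1) ∧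
      stateCode s' < Fintype.card (Ctl σ) + (n + 1) := by
  cases h with
  | @ctl c _ _ _ c' h =>
    refine ⟨stateCode_inl_lt _ _, ?_⟩
    cases c' with
    | none => simp [stateCode]
    | some c' => exact stateCode_inl_lt _ _
  | @load j _ g h =>
    have := loadStep_le g
    simp only [stateCode]
    omega
  | finish => exact ⟨by simp [stateCode], stateCode_inl_lt _ _⟩

/-- The transducer that simulates the program `M` on the input `n`, with all registers
initialized to `r₀`. -/
noncomputable def machine {D : Type*} (r₀ : D) (n : ℕ) :
    SRT (Fin (Fintype.card (Option Act))) (Fin 1) D (Fin (Fintype.card (Ctl σ) + (n + 1)))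
      (Fintype.card Reg) where
  start := ⟨stateCode (.inl (.init₀ : Ctl σ)), stateCode_inl_lt _ _⟩
  reg0 := fun _ => r₀
  trans := {τ | ∃ s a g u s', SimTrans M n s a g u s' ∧ (τ.src : ℕ) = stateCode s ∧
    τ.inLabel = labelEquiv a ∧ τ.guard ∘ regEquiv = g ∧ τ.update ∘ regEquiv = u ∧
    τ.outReg = regEquiv .out ∧ (τ.tgt : ℕ) = stateCode s'}

variable {M}

theorem machine_copying {D : Type*} (r₀ : D) (n : ℕ) : (machine M r₀ n).Copying := by
  rintro τ ⟨s, a, g, u, s', h, -, -, -, hu, ho, -⟩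
  rw [ho]
  exact (congrFun hu _).trans h.update_out

theorem machine_deterministic {D : Type*} (r₀ : D) (n : ℕ) :
    (machine M r₀ n).Deterministic := by
  rintro τ ⟨s, a, g, u, s', h, hs, ha, hg, hu, ho, ht⟩ τ' ⟨s₁, a₁, g₁, u₁, s₁', h', hs', ha', hg',
    hu', ho', ht'⟩ e₁ e₂ e₃
  obtain rfl : s = s₁ := stateCode_injective (by rw [← hs, ← hs', e₁])
  obtain rfl : a = a₁ := labelEquiv.injective (by rw [← ha, ← ha', e₂])
  obtain rfl : g = g₁ := by rw [← hg, ← hg', e₃]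
  obtain ⟨rfl, rfl⟩ := h.unique h'
  ext1
  · exact e₁
  · exact e₂
  · exact e₃
  · exact regEquiv.surjective.injective_comp_right (hu.trans hu'.symm)
  · rw [ho, ho']
  · exact Subsingleton.elim _ _
  · exact Fin.ext (ht.trans ht'.symm)

section Safety

variable {D : Type*} [AddGroup D] [LinearOrder D] {r₀ : D} {n : ℕ}

theorem machine_step_elim {c c' : Fin (Fintype.card (Ctl σ) + (n + 1)) ×
      (Fin (Fintype.card Reg) → D)} {x : Fin (Fintype.card (Option Act)) × D} {y : Fin 1 × D}
    (h : (machine M r₀ n).Step c x y c') {s : Ctl σ ⊕ ℕ} (hs : (c.1 : ℕ) = stateCode s) :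
    ∃ a u s', SimTrans M n s a (fun r => cmp x.2 (c.2 (regEquiv r))) u s' ∧ x.1 = labelEquiv a ∧
      (c'.1 : ℕ) = stateCode s' ∧
      ∀ r, c'.2 (regEquiv r) = (u r).apply (c.2 (regEquiv r)) x.2 := by
  obtain ⟨τ, ⟨s₁, a, g, u, s', h, h₁, h₂, rfl, rfl, -, h₃⟩, e₁, e₂, e₃, e₄, -, e₅⟩ := h
  obtain rfl : s₁ = s := stateCode_injective (by rw [← h₁, ← hs, e₁])
  refine ⟨a, _, s', ?_, by rw [← e₂, h₂], by rw [e₅, h₃], fun r => e₄ _⟩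
  convert h using 1
  · exact funext fun r => (e₃ _).cmp_eq
  · rfl

theorem machine_step_intro {q : Fin (Fintype.card (Ctl σ) + (n + 1))} {R : Reg → D}
    {s s' : Ctl σ ⊕ ℕ} (hs : (q : ℕ) = stateCode s) {a : Option Act} {d : D}
    {u : Reg → RegUpdate} (h : SimTrans M n s a (fun r => cmp d (R r)) u s') :
    ∃ y, (machine M r₀ n).Step (q, R ∘ regEquiv.symm) (labelEquiv a, d) y
      (⟨stateCode s', h.stateCode_lt.2⟩, (fun r => (u r).apply (R r) d) ∘ regEquiv.symm) := by
  refine ⟨_, ⟨q, labelEquiv a, fun i => cmp d (R (regEquiv.symm i)), u ∘ regEquiv.symm,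
    regEquiv .out, 0, ⟨stateCode s', h.stateCode_lt.2⟩⟩, ⟨s, a, _, u, s', h, hs, rfl, ?_, ?_, rfl,
    rfl⟩, rfl, rfl, fun i => cmp_compares _ _, fun i => rfl, rfl, rfl⟩
  · ext; simp
  · ext; simp

theorem machine_reach_of_simReach {s : Ctl σ ⊕ ℕ} {R : Reg → D} (h : SimReach M r₀ n s R) :
    ∃ hs : stateCode s < Fintype.card (Ctl σ) + (n + 1),
      (machine M r₀ n).Reach (⟨stateCode s, hs⟩, R ∘ regEquiv.symm) := by
  induction h with
  | start => exact ⟨stateCode_inl_lt _ _, .start⟩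
  | step _ ht ih =>
    obtain ⟨hs, ih⟩ := ih
    obtain ⟨y, h⟩ := machine_step_intro (q := ⟨_, hs⟩) (r₀ := r₀) rfl ht
    exact ⟨ht.stateCode_lt.2, ih.step h⟩

theorem simInv_of_machine_reach [AddLeftMono D] {c : Fin (Fintype.card (Ctl σ) + (n + 1)) ×
    (Fin (Fintype.card Reg) → D)} (h : (machine M r₀ n).Reach c) :
    ∃ s, (c.1 : ℕ) = stateCode s ∧ SimInv M r₀ n s (c.2 ∘ regEquiv) := by
  induction h with
  | start => exact ⟨.inl .init₀, rfl, fun _ => rfl⟩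
  | step _ h ih =>
    obtain ⟨s, hs, hi⟩ := ih
    obtain ⟨a, u, s', ht, -, hs', hr⟩ := machine_step_elim h hs
    exact ⟨s', hs', hi.trans ht hr⟩

/-- The transducer gets stuck on some input if and only if the program can be executed. -/
theorem machine_safe_iff [AddLeftMono D] [Nontrivial D] :
    (machine M r₀ n).Safe ↔ ¬ ∃ w ∈ M.accepts, (Act.run w (initVal n)).isSome := by
  constructor
  · rintro h ⟨w, hw, hs⟩
    obtain ⟨v, hv⟩ := Option.isSome_iff_exists.1 hs
    obtain ⟨u, -, R, -, hr⟩ := SimReach.run M r₀ n hv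
    obtain ⟨hlt, hr⟩ := machine_reach_of_simReach hr
    obtain ⟨y, c', hc⟩ := h _ hr (labelEquiv none, 0)
    obtain ⟨a, U, s', ht, ha, -⟩ := machine_step_elim (s := .inl (.run (M.eval w))) hc rfl
    obtain rfl := labelEquiv.injective ha
    cases ht with
    | ctl h =>
      rw [ctlStep, if_pos (show M.eval w ∈ M.accept from hw)] at h
      cases h
  · intro h c hc x
    obtain ⟨s, hs, hi⟩ := simInv_of_machine_reach hc
    obtain ⟨u, s', ht⟩ := hi.exists_trans (fun w hw hr => h ⟨w, hw, hr⟩) (labelEquiv.symm x.1)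
      fun r => cmp x.2 (c.2 (regEquiv r))
    obtain ⟨y, hy⟩ := machine_step_intro (r₀ := r₀) (R := c.2 ∘ regEquiv) hs ht
    simp only [Function.comp_assoc, Equiv.self_comp_symm, Function.comp_id,
      Equiv.apply_symm_apply] at hy
    exact ⟨y, _, hy⟩

end Safety

/-! ### Computability of the descriptions -/

instance : Finite RegUpdate :=
  .of_surjective ![.old, .new, .add] (by
    rintro (_ | _ | _)
    exacts [⟨0, rfl⟩, ⟨1, rfl⟩, ⟨2, rfl⟩])

theorem SRT.exists_describes {a b n k : ℕ} {D : Type*} {ν : ℕ → D}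
    (S : SRT (Fin a) (Fin b) D (Fin n) k) (r : Fin k → ℕ) (hr : ∀ i, S.reg0 i = ν (r i)) :
    ∃ c, SRT.Describes ν c S := by
  have : Finite (SRTransition (Fin a) (Fin b) (Fin n) k) := by
    refine Finite.of_injective (fun τ => (τ.src, τ.inLabel, τ.guard, τ.update, τ.outReg,
      τ.outLabel, τ.tgt)) fun τ τ' h => ?_
    simp only [Prod.mk.injEq] at h
    ext1
    exacts [h.1, h.2.1, h.2.2.1, h.2.2.2.1, h.2.2.2.2.1, h.2.2.2.2.2.1, h.2.2.2.2.2.2]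
  obtain ⟨l, hl⟩ := (Set.toFinite (SRT.transCode '' S.trans)).exists_finset_coe
  exact ⟨((a, b, n, k), S.start, List.ofFn r, l.toList), rfl, rfl, ⟨r, rfl, hr⟩, by simpa using hl⟩

/-- The code of the guard of a transition. -/
noncomputable def guardCode (g : Reg → Ordering) : List ℕ :=
  List.ofFn fun i => SRT.cmpCode (g (regEquiv.symm i))

/-- The code of the updates of a transition. -/
noncomputable def updCode (u : Reg → RegUpdate) : List ℕ :=
  List.ofFn fun i => SRT.updateCode (u (regEquiv.symm i))

theorem transCode_machine {D : Type*} (r₀ : D) (n : ℕ) (x : SRT.TransDescr) :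
    x ∈ SRT.transCode '' (machine M r₀ n).trans ↔ ∃ s a g u s', SimTrans M n s a g u s' ∧
      x = (stateCode s, (labelEquiv a : ℕ), guardCode g, updCode u, (regEquiv .out : ℕ), 0,
        stateCode s') := by
  constructor
  · rintro ⟨τ, ⟨s, a, g, u, s', h, h₁, h₂, rfl, rfl, h₃, h₄⟩, rfl⟩
    refine ⟨s, a, _, _, s', h, ?_⟩
    simp [SRT.transCode, h₁, h₂, h₃, h₄, guardCode, updCode]
  · rintro ⟨s, a, g, u, s', h, rfl⟩
    refine ⟨⟨⟨_, h.stateCode_lt.1⟩, labelEquiv a, g ∘ regEquiv.symm, u ∘ regEquiv.symm,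
      regEquiv .out, 0, ⟨_, h.stateCode_lt.2⟩⟩, ⟨s, a, g, u, s', h, rfl, rfl, ?_, ?_, rfl, rfl⟩,
      rfl⟩
    · ext; simp
    · ext; simp

/-- A list of the values of a function on a finite type. -/
theorem exists_list_range {α β : Type*} [Finite α] (f : α → β) :
    ∃ l : List β, ∀ x, x ∈ l ↔ ∃ a, f a = x := by
  obtain ⟨l, hl⟩ := (Set.finite_range f).exists_finset_coe
  exact ⟨l.toList, fun x => by rw [Finset.mem_toList, ← Finset.mem_coe, hl]; rfl⟩

/-- The transducers for the inputs `n` have descriptions that can be computed from `n`. -/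
theorem exists_computable_describes (M : DFA Act σ) {D : Type*} (ν : ℕ → D) :
    ∃ c : ℕ → SRT.Descr, Computable c ∧ ∀ n, SRT.Describes ν (c n) (machine M (ν 0) n) := by
  let o : ℕ := regEquiv .out
  let N : ℕ := Fintype.card (Ctl σ)
  obtain ⟨l₁, h₁⟩ := exists_list_range fun x : {x : (Ctl σ × Option Act × (Reg → Ordering)) ×
      ((Reg → RegUpdate) × Option (Ctl σ)) // ctlStep M x.1.1 x.1.2.1 x.1.2.2 = some x.2} =>
    ((stateCode (.inl x.1.1.1), (labelEquiv x.1.1.2.1 : ℕ), guardCode x.1.1.2.2, updCode x.1.2.1,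
      o, 0, stateCode (x.1.2.2.elim (.inr 0) .inl)) : SRT.TransDescr)
  -- The transitions from loading states depend on `n` only by the numbers of the states.
  obtain ⟨l₂, h₂⟩ := exists_list_range fun x : Option Act × (Reg → Ordering) =>
    ((labelEquiv x.1 : ℕ), guardCode x.2, updCode (loadStep x.2).1, (loadStep x.2).2)
  obtain ⟨l₃, h₃⟩ := exists_list_range fun x : Option Act × (Reg → Ordering) =>
    ((labelEquiv x.1 : ℕ), guardCode x.2)
  let fin : ℕ → ℕ × List ℕ → SRT.TransDescr := fun n t =>
    (N + n, t.1, t.2, updCode idle, o, 0, stateCode (.inl (.run M.start)))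
  let load : ℕ → ℕ × List ℕ × List ℕ × ℕ → SRT.TransDescr := fun j t =>
    (N + j, t.1, t.2.1, t.2.2.1, o, 0, N + (j + t.2.2.2))
  refine ⟨fun n => ((Fintype.card (Option Act), 1, N + (n + 1), Fintype.card Reg),
    stateCode (.inl (.init₀ : Ctl σ)), List.ofFn fun _ : Fin (Fintype.card Reg) => 0,
    l₁ ++ ((List.range n).flatMap (fun j => l₂.map (load j)) ++ l₃.map (fin n))), ?_,
    fun n => ⟨rfl, rfl, ⟨_, rfl, fun _ => rfl⟩, ?_⟩⟩
  · have hadd (m : ℕ) : Primrec fun n => m + n := Primrec.nat_add.comp (.const m) .id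
    have hfin : Primrec₂ fin :=
      ((hadd N).comp .fst).pair ((Primrec.fst.comp .snd).pair ((Primrec.snd.comp .snd).pair
        (.const _)))
    have hload : Primrec₂ load := by
      refine ((hadd N).comp .fst).pair ((Primrec.fst.comp .snd).pair
        ((Primrec.fst.comp (.comp .snd .snd)).pair
          ((Primrec.fst.comp (.comp .snd (.comp .snd .snd))).pair
            ((Primrec.const o).pair ((Primrec.const 0).pair ((hadd N).comp ?_))))))
      exact Primrec.nat_add.comp .fst (.comp .snd (.comp .snd (.comp .snd .snd)))
    refine Primrec.to_comp ?_
    refine Primrec.pair ((Primrec.const _).pair ((Primrec.const _).pair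
      (((hadd N).comp .succ).pair (.const _)))) ((Primrec.const _).pair ((Primrec.const _).pair ?_))
    refine Primrec.list_append.comp (.const _) (Primrec.list_append.comp ?_ ?_)
    · refine Primrec.list_flatMap .list_range (Primrec.list_map (.const _) ?_)
      exact hload.comp (.comp .snd .fst) .snd
    · exact Primrec.list_map (.const _) hfin
  · ext x
    rw [transCode_machine]
    simp only [Set.mem_ofPred_eq, List.mem_append, List.mem_flatMap, List.mem_range, List.mem_map]
    constructor
    · rintro (hx | ⟨j, hj, t, ht, rfl⟩ | ⟨t, ht, rfl⟩)
      · obtain ⟨⟨p, hp⟩, rfl⟩ := (h₁ x).1 hx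
        exact ⟨_, _, _, _, _, .ctl hp, rfl⟩
      · obtain ⟨p, rfl⟩ := (h₂ t).1 ht
        exact ⟨_, p.1, p.2, _, _, .load hj, rfl⟩
      · obtain ⟨p, rfl⟩ := (h₃ t).1 ht
        exact ⟨_, p.1, p.2, _, _, .finish, rfl⟩
    · rintro ⟨s, a, g, u, s', h, rfl⟩
      cases h with
      | @ctl c _ _ _ c' h => exact .inl ((h₁ _).2 ⟨⟨((c, a, g), (u, c')), h⟩, rfl⟩)
      | @load j _ _ hj => exact .inr (.inl ⟨j, hj, _, (h₂ _).2 ⟨(a, g), rfl⟩, rfl⟩)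
      | finish => exact .inr (.inr ⟨_, (h₃ _).2 ⟨(a, g), rfl⟩, rfl⟩)

end Machine

theorem mainTheorem4 {D : Type*} [AddGroup D] [LinearOrder D] [AddLeftMono D] [AddRightMono D]
    [Infinite D] (ν : ℕ → D) :
    (¬ SRT.DSRTReactivityDecidable ν ∧
      ¬ SRT.SRTReactivityDecidable ν ∧
      ¬ SRT.SRTInclusionDecidable ν) ∧
    (¬ SRT.DSRTOmegaReactivityDecidable ν ∧
      ¬ SRT.SRTOmegaReactivityDecidable ν ∧
      ¬ SRT.SRTOmegaInclusionDecidable ν) := by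
  obtain ⟨_, ⟨σ, _, M, rfl⟩, hK⟩ := exists_isRegular_not_computablePred
  obtain ⟨c, hc, hd⟩ := exists_computable_describes M ν
  have hsafe n := machine_safe_iff (M := M) (r₀ := ν 0) (n := n)
  have hdet n := machine_deterministic (M := M) (ν 0) n
  have hcop n := machine_copying (M := M) (ν 0) n
  let T := SRT.identity (Fin (Fintype.card (Option Act))) (ν 0)
  obtain ⟨e, he⟩ := SRT.exists_describes (ν := ν) T (fun _ => 0) fun _ => rfl
  have key : ∀ f : ℕ → Bool, Computable f → ¬ ∀ n, f n = true ↔ (machine M (ν 0) n).Safe := by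
    intro f hf h
    refine hK (ComputablePred.not ?_ |>.of_eq fun n => not_not)
    refine ComputablePred.computable_iff.2 ⟨f, hf, funext fun n => propext ?_⟩
    rw [h, hsafe]
  have hpair : Computable fun n => (e, c n) := (Computable.const e).pair hc
  refine ⟨⟨?_, ?_, ?_⟩, ?_, ?_, ?_⟩
  · rintro ⟨f, hf, h⟩
    exact key _ (hf.comp hc) fun n =>
      (h _ _ _ _ _ _ (hd n) (hdet n)).trans (hdet n).reactive_iff_safe
  · rintro ⟨f, hf, h⟩
    exact key _ (hf.comp hc) fun n => (h _ _ _ _ _ _ (hd n)).trans (hdet n).reactive_iff_safe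
  · rintro ⟨f, hf, h⟩
    refine key _ (hf.comp hpair) fun n => (h _ _ _ _ _ _ _ _ _ _ he (hd n)).trans ?_
    rw [(SRT.identity_copying _).lang_subset_iff
      ((SRT.identity_deterministic _).reactive_iff_safe.2 (SRT.identity_safe _)) (hcop n)]
    exact (hdet n).reactive_iff_safe
  · rintro ⟨f, hf, h⟩
    exact key _ (hf.comp hc) fun n =>
      (h _ _ _ _ _ _ (hd n) (hdet n)).trans (hdet n).omegaReactive_iff_safe
  · rintro ⟨f, hf, h⟩
    exact key _ (hf.comp hc) fun n =>
      (h _ _ _ _ _ _ (hd n)).trans (hdet n).omegaReactive_iff_safe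
  · rintro ⟨f, hf, h⟩
    refine key _ (hf.comp hpair) fun n => (h _ _ _ _ _ _ _ _ _ _ he (hd n)).trans ?_
    rw [(SRT.identity_copying _).omegaLang_subset_iff
      ((SRT.identity_deterministic _).omegaReactive_iff_safe.2 (SRT.identity_safe _)) (hcop n)]
    exact (hdet n).omegaReactive_iff_safe
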